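/- Let $\Sigma$ be a complex surface and let $(V,\langle\cdot,\cdot\rangle,\Lambda,\mathcal D)$ be a holomorphic conformal Cartan connection on $\Sigma$: $V$ is a holomorphic vector bundle of rank $4$ with a nondegenerate symmetric holomorphic bilinear form, $\Lambda\subset V$ is a null line subbundle, and $\mathcal D$ is a holomorphic metric connection on $V$ such that $\epsilon:=\mathcal D|_\Lambda \bmod \Lambda$ is an isomorphism $T\Sigma\otimes\Lambda\to\Lambda^\perp/\Lambda$. Suppose that $V$ is associated to the tangent bundle $T\Sigma$ through a holomorphic representation of $GL(2,\mathbb C)$ on $\mathbb C^4$, so that a local biholomorphism $\phi$ of $\Sigma$ acts on $V$ by the induced map $\phi_*$. Suppose that the null vectors of $\Lambda^\perp$ form two holomorphic rank-two subbundles $U^+,U^-$ with $U^+\cap U^-=\Lambda$. Define the line subbundles $t^\pm\subset T\Sigma$ by $\epsilon(t^\pm\otimes\Lambda)=U^\pm/\Lambda$, let $C^\pm$ be the families of their integral curves, and let $F^\pm=\mathbb P(U^\pm)$. The $\mathcal D$-horizontal lifts of the curves of $C^\pm$ to $F^\pm$ foliate $F^\pm$; let $T^\pm$ be the leaf spaces.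 Write $a\sim b$ for $a\in T^+$, $b\in T^-$ if $a\cap b=\{\mathbb P(\Lambda)_\sigma\}$ for some $\sigma\in\Sigma$ (leaves being regarded as subsets of $\mathbb P(V)$), and let $T=T^+\sqcup_\sim T^-$ be the quotient of $T^+\sqcup T^-$ by the equivalence relation generated by $\sim$. Suppose that $\Sigma$ has been restricted so that a leaf of $F^+$ and a leaf of $F^-$ always meet in at most one point, that $T^\pm$ are (Hausdorff) complex surfaces for which $F^\pm\to T^\pm$ is a holomorphic submersion, and that $T$ is a (Hausdorff) complex surface with the structure glued from those of $T^\pm$, i.e. such that $T^\pm\to T$ are local biholomorphisms. Let $X$ be a holomorphic vector field on $\Sigma$ and let $\phi_t$ be a holomorphic local flow of $X$ (complex time, defined on an open neighbourhood $\mathcal U$ of $\{0\}\times\Sigma$ in $\mathbb C\times\Sigma$ whose slices $\{t : (t,x)\in\mathcal U\}$ are star-shaped about $0$) which preserves the Cartan connection: for $(t,x)\in\mathcal U$ the induced map $(\phi_t)_*:V_x\to V_{\phi_t(x)}$ preserves $\Lambda$, the inner product and $\mathcal D$. Then: 1. The maps $(\sigma,v)\mapsto(\phi_t(\sigma),(\phi_t)_*v)$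 preserve $U^\pm$ and induce holomorphic local flows $\phi'^{\pm}_t$ with holomorphic generators on $T^\pm$: the leaf through $(\sigma,[v])\in F^\pm$ is sent to the leaf through $(\phi_t(\sigma),[(\phi_t)_*v])$ whenever $(t,\sigma)\in\mathcal U$. Here $\phi'^\pm_t(a)$ is defined exactly when the leaf $a$ contains a point over some $\sigma$ with $(t,\sigma)\in\mathcal U$. 2. These flows are compatible with the gluing. If $a\cap b=\{\mathbb P(\Lambda)_\sigma\}$ and $(t,\sigma)\in\mathcal U$, then $\phi'^+_t(a)\cap\phi'^-_t(b)=\{\mathbb P(\Lambda)_{\phi_t(\sigma)}\}$. If $a\sim b$ and $\phi'^+_t(a)$, $\phi'^-_t(b)$ are both defined, then they have the same image in $T$. 3. Hence they define a holomorphic local flow on $T$, defined exactly at the pairs $(t,c)$ such that $c$ is the image of some $a\in T^\pm$ with $\phi'^\pm_t(a)$ defined, and sending $c$ to the image of $\phi'^\pm_t(a)$. Its generator is a holomorphic vector field on $T$. -/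

import Mathlib

open Set Filter Topology Bundle
open scoped Manifold ContDiff LinearAlgebra.Projectivization

noncomputable section

namespace CartanGluing

/-! ### Complex surfaces, holomorphic vector fields, local flows -/

/-- The model space `ℂ²` of complex surfaces. -/
abbrev C2 : Type := EuclideanSpace ℂ (Fin 2)

/-- The model fibre `ℂ⁴` of the bundle `V` (rank `n + 2` with `n = 2`). -/
abbrev C4 : Type := EuclideanSpace ℂ (Fin 4)

section Flow

variable {M : Type*} [TopologicalSpace M] [ChartedSpace C2 M]

/-- A vector field is holomorphic if it is a holomorphic section of the tangent bundle. -/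
def IsHolomorphicVectorField [IsManifold 𝓘(ℂ, C2) ω M]
    (X : Π x : M, TangentSpace 𝓘(ℂ, C2) x) : Prop :=
  ContMDiff 𝓘(ℂ, C2) 𝓘(ℂ, C2).tangent ω (fun x : M => (⟨x, X x⟩ : TangentBundle 𝓘(ℂ, C2) M))

/-- A holomorphic local one-parameter group of transformations with generator `X`: a local flow
`φ_t x` (with complex time `t`), defined on an open neighbourhood of `{0} × M` in `ℂ × M` whose
slices `{t | (t, x) ∈ domain}` are star-shaped about `0`. The values of `toFun` outside `domain`
carry no meaning. -/
structure LocalFlow (X : Π x : M, TangentSpace 𝓘(ℂ, C2) x) where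
  domain : Set (ℂ × M)
  isOpen_domain : IsOpen domain
  zero_mem : ∀ x, ((0 : ℂ), x) ∈ domain
  star_mem : ∀ (t : ℂ) (x : M), (t, x) ∈ domain →
    ∀ r : ℝ, 0 ≤ r → r ≤ 1 → ((r : ℂ) * t, x) ∈ domain
  toFun : ℂ → M → M
  holomorphic : ContMDiffOn (𝓘(ℂ, ℂ).prod 𝓘(ℂ, C2)) 𝓘(ℂ, C2) ω
    (fun p : ℂ × M => toFun p.1 p.2) domain
  map_zero : ∀ x, toFun 0 x = x
  velocity : ∀ (t : ℂ) (x : M), (t, x) ∈ domain →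
    HasMFDerivAt 𝓘(ℂ, ℂ) 𝓘(ℂ, C2) (fun s : ℂ => toFun s x) t
      ((1 : ℂ →L[ℂ] ℂ).smulRight (X (toFun t x)))
  map_add : ∀ (t : ℂ) (x : M), (t, x) ∈ domain →
    ∀ᶠ q : ℂ × (ℂ × M) in 𝓝 ((0 : ℂ), (t, x)),
      toFun (q.2.1 + q.1) q.2.2 = toFun q.1 (toFun q.2.1 q.2.2)

end Flow

/-! ### Vector bundles associated to the tangent bundle -/

/-- A holomorphic representation of `GL(2, ℂ)` on `ℂ⁴`. -/
structure HolRep where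
  toHom : (C2 →L[ℂ] C2)ˣ →* (C4 →L[ℂ] C4)ˣ
  holomorphic : ∀ A : (C2 →L[ℂ] C2)ˣ, ∃ f : (C2 →L[ℂ] C2) → (C4 →L[ℂ] C4),
    ContDiffAt ℂ ω f A ∧ ∀ᶠ B in 𝓝 (A : C2 →L[ℂ] C2), ∀ u : (C2 →L[ℂ] C2)ˣ,
      (u : C2 →L[ℂ] C2) = B → f B = (toHom u : C4 →L[ℂ] C4)

open Classical in
/-- The representation as a map on all endomorphisms of `ℂ²`; it has the junk value `0` on
singular endomorphisms. -/
def HolRep.ext (ρ : HolRep) (A : C2 →L[ℂ] C2) : C4 →L[ℂ] C4 :=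
  if h : IsUnit A then (ρ.toHom h.unit : C4 →L[ℂ] C4) else 0

theorem HolRep.ext_unit (ρ : HolRep) (u : (C2 →L[ℂ] C2)ˣ) :
    ρ.ext (u : C2 →L[ℂ] C2) = (ρ.toHom u : C4 →L[ℂ] C4) := by
  have h : IsUnit (u : C2 →L[ℂ] C2) := u.isUnit
  have hu : h.unit = u := Units.ext rfl
  simp [HolRep.ext]

theorem HolRep.contDiffAt_ext (ρ : HolRep) (u : (C2 →L[ℂ] C2)ˣ) :
    ContDiffAt ℂ ω ρ.ext (u : C2 →L[ℂ] C2) := by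
  obtain ⟨f, hf, hfe⟩ := ρ.holomorphic u
  refine hf.congr_of_eventuallyEq ?_
  filter_upwards [hfe, Units.nhds u] with B hB hBu
  obtain ⟨v, rfl⟩ := hBu
  rw [HolRep.ext_unit, hB v rfl]

section Associated

variable (S : Type*) [TopologicalSpace S] [ChartedSpace C2 S] [IsManifold 𝓘(ℂ, C2) ω S]

theorem isUnit_coordChange (i j : atlas C2 S) (x : S)
    (hx : x ∈ (tangentBundleCore 𝓘(ℂ, C2) S).baseSet i ∩
      (tangentBundleCore 𝓘(ℂ, C2) S).baseSet j) :
    IsUnit ((tangentBundleCore 𝓘(ℂ, C2) S).coordChange i j x) := by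
  set Z := tangentBundleCore 𝓘(ℂ, C2) S
  refine ⟨⟨Z.coordChange i j x, Z.coordChange j i x, ?_, ?_⟩, rfl⟩
  · ext1 v
    have := Z.coordChange_comp j i j x ⟨⟨hx.2, hx.1⟩, hx.2⟩ v
    rw [Z.coordChange_self j x hx.2] at this
    exact this
  · ext1 v
    have := Z.coordChange_comp i j i x ⟨⟨hx.1, hx.2⟩, hx.1⟩ v
    rw [Z.coordChange_self i x hx.1] at this
    exact this

/-- The vector bundle with fibre `ℂ⁴` associated to (the frame bundle of) the tangent bundle of the
complex surface `S` through the representation `ρ`: it is trivial over each chart, with the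
transition functions `ρ (D (j ∘ i⁻¹))`. -/
def assocCore (ρ : HolRep) : VectorBundleCore ℂ S C4 (atlas C2 S) where
  baseSet := (tangentBundleCore 𝓘(ℂ, C2) S).baseSet
  isOpen_baseSet := (tangentBundleCore 𝓘(ℂ, C2) S).isOpen_baseSet
  indexAt := (tangentBundleCore 𝓘(ℂ, C2) S).indexAt
  mem_baseSet_at := (tangentBundleCore 𝓘(ℂ, C2) S).mem_baseSet_at
  coordChange i j x := ρ.ext ((tangentBundleCore 𝓘(ℂ, C2) S).coordChange i j x)
  coordChange_self i x hx v := by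
    have h : (tangentBundleCore 𝓘(ℂ, C2) S).coordChange i i x
        = ((1 : (C2 →L[ℂ] C2)ˣ) : C2 →L[ℂ] C2) := by
      ext1 w
      exact (tangentBundleCore 𝓘(ℂ, C2) S).coordChange_self i x hx w
    rw [h, HolRep.ext_unit]
    simp
  continuousOn_coordChange i j x hx := by
    obtain ⟨u, hu⟩ := isUnit_coordChange S i j x hx
    have h1 := (tangentBundleCore 𝓘(ℂ, C2) S).continuousOn_coordChange i j x hx
    have h2 := (ρ.contDiffAt_ext u).continuousAt
    rw [hu] at h2
    exact ContinuousAt.comp_continuousWithinAt (g := ρ.ext) h2 h1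
  coordChange_comp i j k x hx v := by
    obtain ⟨a, ha⟩ := isUnit_coordChange S i j x ⟨hx.1.1, hx.1.2⟩
    obtain ⟨b, hb⟩ := isUnit_coordChange S j k x ⟨hx.1.2, hx.2⟩
    have h : (tangentBundleCore 𝓘(ℂ, C2) S).coordChange i k x
        = ((b * a : (C2 →L[ℂ] C2)ˣ) : C2 →L[ℂ] C2) := by
      ext1 w
      rw [Units.val_mul, ha, hb]
      exact ((tangentBundleCore 𝓘(ℂ, C2) S).coordChange_comp i j k x hx w).symm
    rw [h, ← ha, ← hb, HolRep.ext_unit, HolRep.ext_unit, HolRep.ext_unit, map_mul]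
    rfl

instance assocCore_isContMDiff (ρ : HolRep) :
    (assocCore S ρ).IsContMDiff 𝓘(ℂ, C2) ω where
  contMDiffOn_coordChange i j x hx := by
    obtain ⟨u, hu⟩ := isUnit_coordChange S i j x hx
    have : IsManifold 𝓘(ℂ, C2) (ω + 1) S := ‹IsManifold 𝓘(ℂ, C2) ω S›
    have : (tangentBundleCore 𝓘(ℂ, C2) S).IsContMDiff 𝓘(ℂ, C2) ω :=
      tangentBundleCore.isContMDiff
    have h1 := (tangentBundleCore 𝓘(ℂ, C2) S).contMDiffOn_coordChange (n := ω) 𝓘(ℂ, C2) i j x hx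
    have h2 := (ρ.contDiffAt_ext u).contMDiffAt
    rw [hu] at h2
    exact ContMDiffAt.comp_contMDiffWithinAt (g := ρ.ext) x h2 h1

end Associated

section Main

variable {S : Type*} [TopologicalSpace S] [ChartedSpace C2 S] [IsManifold 𝓘(ℂ, C2) ω S]
  {ρ : HolRep}

/-- The fibre at `x` of the associated bundle `V`. -/
abbrev V (ρ : HolRep) (x : S) : Type := (assocCore S ρ).Fiber x

instance (x : S) : IsTopologicalAddGroup (V ρ x) :=
  inferInstanceAs (IsTopologicalAddGroup C4)

instance (x : S) : ContinuousSMul ℂ (V ρ x) :=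
  inferInstanceAs (ContinuousSMul ℂ C4)

/-- The total space of the associated bundle `V`. -/
abbrev TotV (S : Type*) [TopologicalSpace S] [ChartedSpace C2 S] [IsManifold 𝓘(ℂ, C2) ω S]
    (ρ : HolRep) := TotalSpace C4 (fun x : S => V ρ x)

/-- The section `e` of `V` is holomorphic near `x`. -/
def HolAt (e : Π y : S, V ρ y) (x : S) : Prop :=
  ContMDiffAt 𝓘(ℂ, C2) (𝓘(ℂ, C2).prod 𝓘(ℂ, C4)) ω (fun y : S => (⟨y, e y⟩ : TotV S ρ)) x

/-- A family of subspaces of the fibres of `V` is a holomorphic subbundle of rank `k` if locally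
it is spanned by a frame of `k` holomorphic sections. -/
def IsHolSubbundle (k : ℕ) (W : Π x : S, Submodule ℂ (V ρ x)) : Prop :=
  ∀ x : S, ∃ e : Fin k → Π y : S, V ρ y, (∀ i, HolAt (e i) x) ∧
    ∀ᶠ y in 𝓝 x, LinearIndependent ℂ (fun i => e i y) ∧
      Submodule.span ℂ (range fun i => e i y) = W y

/-- The map `(φ_t)_* : V_x → V_{φ_t x}` induced by the differential of `φ_t`. Both fibres are
written in the frames given by the preferred charts at `x` and `φ_t x`, and `mfderiv` is the
Jacobian of `φ_t` in the same charts. -/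
def push (ρ : HolRep) {X : Π x : S, TangentSpace 𝓘(ℂ, C2) x} (φ : LocalFlow X) (t : ℂ) (x : S) :
    V ρ x → V ρ (φ.toFun t x) :=
  fun v => ρ.ext (mfderiv 𝓘(ℂ, C2) 𝓘(ℂ, C2) (φ.toFun t) x : C2 →L[ℂ] C2) v

variable (S ρ) in
/-- A holomorphic conformal Cartan connection `(V, ⟨.,.⟩, Λ, 𝒟)` on the complex surface `S`, with
`V` the bundle associated to `TS` through `ρ`. -/
structure ConformalCartan where
  /-- the (complex bilinear) inner product on `V` -/
  inner : Π x : S, V ρ x →ₗ[ℂ] V ρ x →ₗ[ℂ] ℂ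
  inner_symm : ∀ x v w, inner x v w = inner x w v
  inner_nondeg : ∀ x v, (∀ w, inner x v w = 0) → v = 0
  inner_holomorphic : ∀ (e f : Π y : S, V ρ y) (x : S), HolAt e x → HolAt f x →
    ContMDiffAt 𝓘(ℂ, C2) 𝓘(ℂ, ℂ) ω (fun y => inner y (e y) (f y)) x
  /-- the null line subbundle -/
  L : Π x : S, Submodule ℂ (V ρ x)
  L_holomorphic : IsHolSubbundle 1 L
  L_null : ∀ x, ∀ v ∈ L x, inner x v v = 0
  /-- the linear connection; `D e x w` is `𝒟_w e` at the point `x` -/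
  D : CovariantDerivative 𝓘(ℂ, C2) C4 (fun x : S => V ρ x)
  D_holomorphic : ∀ u : Set S, IsOpen u → ContMDiffCovariantDerivativeOn C4 ω D.toFun u
  /-- `𝒟` is a metric connection -/
  D_metric : ∀ (e f : Π y : S, V ρ y) (x : S), HolAt e x → HolAt f x →
    ∀ w : TangentSpace 𝓘(ℂ, C2) x,
      (mfderiv 𝓘(ℂ, C2) 𝓘(ℂ, ℂ) (fun y => inner y (e y) (f y)) x w : ℂ) =
        inner x (D.toFun e x w) (f x) + inner x (e x) (D.toFun f x w)
  /-- Cartan condition: for a nonzero element `e x` of `Λ_x`, extended to a section `e` of `Λ`, the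
  map `w ↦ 𝒟_w e mod Λ` is an isomorphism from `T_x S` to `Λ_x^⊥ / Λ_x`. -/
  cartan : ∀ (x : S) (e : Π y : S, V ρ y), HolAt e x → (∀ᶠ y in 𝓝 x, e y ∈ L y) → e x ≠ 0 →
    (∀ w : TangentSpace 𝓘(ℂ, C2) x, ∀ l ∈ L x, inner x (D.toFun e x w) l = 0) ∧
    ∀ a : V ρ x, (∀ l ∈ L x, inner x a l = 0) →
      ∃! w : TangentSpace 𝓘(ℂ, C2) x, D.toFun e x w - a ∈ L x

/-- The Cartan connection is preserved by the local flow `φ` of the vector field `X`, where `φ_t`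
acts on `V` by the induced maps `(φ_t)_*`: they preserve `Λ`, the inner product and `𝒟`. A
vector field `X` with such a flow is a symmetry. In the last field `f = (φ_t)_* e` near `φ_t x`. -/
structure ConformalCartan.IsPreservedBy (C : ConformalCartan S ρ)
    {X : Π x : S, TangentSpace 𝓘(ℂ, C2) x} (φ : LocalFlow X) : Prop where
  line : ∀ (t : ℂ) (x : S), (t, x) ∈ φ.domain →
    ∀ v ∈ C.L x, push ρ φ t x v ∈ C.L (φ.toFun t x)
  inner : ∀ (t : ℂ) (x : S), (t, x) ∈ φ.domain →
    ∀ v w : V ρ x, C.inner (φ.toFun t x) (push ρ φ t x v) (push ρ φ t x w) = C.inner x v w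
  connection : ∀ (t : ℂ) (x : S), (t, x) ∈ φ.domain →
    ∀ e f : Π y : S, V ρ y, HolAt e x → HolAt f (φ.toFun t x) →
      (∀ᶠ y in 𝓝 x, f (φ.toFun t y) = push ρ φ t y (e y)) →
      ∀ w : TangentSpace 𝓘(ℂ, C2) x,
        C.D.toFun f (φ.toFun t x) (mfderiv 𝓘(ℂ, C2) 𝓘(ℂ, C2) (φ.toFun t) x w) =
          push ρ φ t x (C.D.toFun e x w)

/-- The labels `+` and `-`. -/
inductive Side : Type
  | plus : Side
  | minus : Side

/-- The null subbundles `U⁺, U⁻ ⊆ Λ^⊥`: rank two holomorphic subbundles with `U⁺ ∩ U⁻ = Λ` whose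
fibres make up the solutions in `Λ^⊥` of `⟨a, a⟩ = 0`. They are determined by the Cartan connection
up to their labelling. -/
structure NullSubbundles (C : ConformalCartan S ρ) where
  U : Side → Π x : S, Submodule ℂ (V ρ x)
  holomorphic : ∀ s, IsHolSubbundle 2 (U s)
  inter : ∀ x, U .plus x ⊓ U .minus x = C.L x
  mem_iff : ∀ x (a : V ρ x), (a ∈ U .plus x ∨ a ∈ U .minus x) ↔
    (∀ l ∈ C.L x, C.inner x a l = 0) ∧ C.inner x a a = 0

theorem ConformalCartan.finrank_L (C : ConformalCartan S ρ) (x : S) :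
    Module.finrank ℂ (C.L x) = 1 := by
  obtain ⟨e, -, he⟩ := C.L_holomorphic x
  obtain ⟨hli, hsp⟩ := he.self_of_nhds
  rw [← hsp, finrank_span_eq_card hli]
  simp

namespace NullSubbundles

variable {C : ConformalCartan S ρ} (N : NullSubbundles C)

/-- The line subbundles `t^±` of `TS`, defined by `ε(t^± ⊗ Λ) = U^± / Λ`, where
`ε(w ⊗ e) = 𝒟_w e mod Λ`. -/
def tangentLine (s : Side) (x : S) : Submodule ℂ (TangentSpace 𝓘(ℂ, C2) x) where
  carrier := {w | ∀ e : Π y : S, V ρ y, HolAt e x → (∀ᶠ y in 𝓝 x, e y ∈ C.L y) →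
    C.D.toFun e x w ∈ N.U s x}
  add_mem' := by
    intro a b ha hb e he hL
    rw [map_add]
    exact (N.U s x).add_mem (ha e he hL) (hb e he hL)
  zero_mem' := by
    intro e _ _
    rw [map_zero]
    exact (N.U s x).zero_mem
  smul_mem' := by
    intro c a ha e he hL
    rw [map_smul]
    exact (N.U s x).smul_mem c (ha e he hL)

variable (ρ) in
/-- The total space of the projective bundle `ℙ(V)`. -/
abbrev ProjV (S : Type*) [TopologicalSpace S] [ChartedSpace C2 S] [IsManifold 𝓘(ℂ, C2) ω S] :=
  Σ x : S, ℙ ℂ (V ρ x)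

/-- The total space of the bundle `F^± = ℙ(U^±)`. -/
def F (s : Side) := {p : ProjV ρ S // p.2.submodule ≤ N.U s p.1}

/-- The nonzero vectors of `U^±`, a `ℂˣ`-bundle over `F^±`. -/
def NonzeroU (s : Side) := {v : TotV S ρ // v.2 ∈ N.U s v.1 ∧ v.2 ≠ 0}

/-- The projection from the nonzero vectors of `U^±` to `F^±`. -/
def toF (s : Side) (v : N.NonzeroU s) : N.F s :=
  ⟨⟨v.1.1, Projectivization.mk ℂ v.1.2 v.2.2⟩, by
    rw [Projectivization.submodule_mk, Submodule.span_singleton_le_iff_mem]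
    exact v.2.1⟩

/-- The holomorphic curve `g` in `U^± ∖ 0`, defined on the unit disc, is a `𝒟`-horizontal lift of
an (immersed) integral curve of `t^±`, that is, of a piece of a curve of the family `C^±`.
Horizontality at `z`: the curve is tangent at `z` to a local section `e` of `V` through `g z` whose
covariant derivative in the direction of the base curve vanishes at that point. -/
structure IsLiftedCurve (s : Side) (g : ℂ → N.NonzeroU s) : Prop where
  holomorphic : ContMDiffOn 𝓘(ℂ, ℂ) (𝓘(ℂ, C2).prod 𝓘(ℂ, C4)) ω (fun z => (g z).1)
    (Metric.ball (0 : ℂ) 1)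
  integral : ∀ z ∈ Metric.ball (0 : ℂ) 1,
    mfderiv 𝓘(ℂ, ℂ) 𝓘(ℂ, C2) (fun z => (g z).1.1) z (1 : ℂ) ≠ 0 ∧
    mfderiv 𝓘(ℂ, ℂ) 𝓘(ℂ, C2) (fun z => (g z).1.1) z (1 : ℂ) ∈ N.tangentLine s (g z).1.1
  horizontal : ∀ z ∈ Metric.ball (0 : ℂ) 1, ∃ e : Π y : S, V ρ y,
    HolAt e (g z).1.1 ∧ e (g z).1.1 = (g z).1.2 ∧
    C.D.toFun e (g z).1.1 (mfderiv 𝓘(ℂ, ℂ) 𝓘(ℂ, C2) (fun z => (g z).1.1) z (1 : ℂ)) = 0 ∧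
    (mfderiv 𝓘(ℂ, ℂ) (𝓘(ℂ, C2).prod 𝓘(ℂ, C4))
        (fun z => (⟨(g z).1.1, e (g z).1.1⟩ : TotV S ρ)) z (1 : ℂ) : C2 × C4) =
      mfderiv 𝓘(ℂ, ℂ) (𝓘(ℂ, C2).prod 𝓘(ℂ, C4)) (fun z => (g z).1) z (1 : ℂ)

/-- Two points of `F^±` lie on one lifted curve piece. -/
def LeafRel (s : Side) (p q : N.F s) : Prop :=
  ∃ g : ℂ → N.NonzeroU s, N.IsLiftedCurve s g ∧
    ∃ z ∈ Metric.ball (0 : ℂ) 1, ∃ w ∈ Metric.ball (0 : ℂ) 1,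
      N.toF s (g z) = p ∧ N.toF s (g w) = q

/-- The leaf space `T^±` of the foliation of `F^±` by the lifted curves: the quotient of `F^±` by
the equivalence relation generated by lying on one lifted curve piece. -/
def LeafSpace (s : Side) := Quot (N.LeafRel s)

/-- The leaf through a point of `F^±`. -/
def leaf (s : Side) (p : N.F s) : N.LeafSpace s := Quot.mk _ p

/-- A leaf as a subset of `F^± ⊆ ℙ(V)`. -/
def leafSet (s : Side) (a : N.LeafSpace s) : Set (ProjV ρ S) :=
  {x | ∃ p : N.F s, N.leaf s p = a ∧ p.1 = x}

/-- The point `ℙ(Λ)_σ` of `ℙ(V)`. -/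
def linePoint (C : ConformalCartan S ρ) (x : S) : ProjV ρ S :=
  ⟨x, Projectivization.mk'' (C.L x) (C.finrank_L x)⟩

/-- The gluing relation between `T⁺` and `T⁻`. -/
def Glue (a : N.LeafSpace .plus) (b : N.LeafSpace .minus) : Prop :=
  ∃ x : S, N.leafSet .plus a ∩ N.leafSet .minus b = {linePoint C x}

/-- The glued space `T = T⁺ ⊔_∼ T⁻`. -/
def Glued := Quot (fun u v : N.LeafSpace .plus ⊕ N.LeafSpace .minus =>
  ∃ a b, u = Sum.inl a ∧ v = Sum.inr b ∧ N.Glue a b)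

/-- The natural maps `T^± → T`. -/
def toGlued : (s : Side) → N.LeafSpace s → N.Glued
  | .plus => fun a => Quot.mk _ (Sum.inl a)
  | .minus => fun b => Quot.mk _ (Sum.inr b)

/-- The leaf space `T^±`, with the given structure of a complex surface, is the quotient manifold
of `F^±`: the map from `F^±` to `T^±` is a holomorphic submersion. Both properties are expressed on
the nonzero vectors of `U^±`: the leaf map is holomorphic along every holomorphic family of
nonzero vectors of `U^±`, and through every such vector there is a local holomorphic section. (At
most one complex structure on `T^±` has these properties.) -/
structure IsLeafManifold (s : Side) [TopologicalSpace (N.LeafSpace s)]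
    [ChartedSpace C2 (N.LeafSpace s)] : Prop where
  holomorphic : ∀ (G : Type) [NormedAddCommGroup G] [NormedSpace ℂ G] [FiniteDimensional ℂ G]
    (g : G → N.NonzeroU s) (z : G),
    ContMDiffAt 𝓘(ℂ, G) (𝓘(ℂ, C2).prod 𝓘(ℂ, C4)) ω (fun z => (g z).1) z →
    ContMDiffAt 𝓘(ℂ, G) 𝓘(ℂ, C2) ω (fun z => N.leaf s (N.toF s (g z))) z
  submersion : ∀ v : N.NonzeroU s, ∃ c : N.LeafSpace s → N.NonzeroU s,
    ContMDiffAt 𝓘(ℂ, C2) (𝓘(ℂ, C2).prod 𝓘(ℂ, C4)) ω (fun a => (c a).1) (N.leaf s (N.toF s v)) ∧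
    c (N.leaf s (N.toF s v)) = v ∧
    ∀ᶠ a in 𝓝 (N.leaf s (N.toF s v)), N.leaf s (N.toF s (c a)) = a

end NullSubbundles

end Main

end CartanGluing

end

/-! The flow acts on the fibres of `V` by isometries preserving `Λ`, so it maps null vectors of
`Λ^⊥` to such vectors, i.e. it preserves the union of `U⁺` and `U⁻`. It cannot exchange the two: on
the segment from `0` to `t` the times at which `U^±` keeps its label form a clopen set containing
`0` (`push_mem_U`). Since the flow also preserves `𝒟`, it carries `t^±` into itself and horizontal
lifts to horizontal lifts (`jac_mem_tangentLine`, `IsLiftedAt.push`).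

The difficulty is that the flow is only local. At a time `t` a leaf may contain points where `φ_t`
is defined and points where it is not, so a chain of lifted curves joining two points of a leaf need
not be pushed forward as a whole. For small times it can be, and the image leaves agree as germs in
`t` at `0` (`eventually_leaf_flowU_eq`). The passage to all times is a general descent along a map
`p : E → B`, abstracted in `DescendingFlow`. For two points of one fibre, the set of times of
agreement on the segment to `t` is open by the local flow law and the germ condition, and closed
because `B` is Hausdorff; star-shapedness keeps both points in the domain on the way (`flow_eq`).
Holomorphy and the flow law on `B` are read off from local sections of `p`.

The descent is used twice: from the nonzero vectors of `U^±` to the leaf spaces (`leafFlow`), and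
from the disjoint union of `T⁺` and `T⁻` to `T` (`gluedFlow`). In the second case the germ condition
holds because the meeting point `ℙ(Λ)_σ` of two glued leaves moves to `ℙ(Λ)_{φ_t σ}`, and leaves
meet at most once, so the gluing persists for small times. -/

namespace CartanGluing

/-! ### Holomorphy of the generator of a local flow. -/

section LocalFlow

variable {M : Type*} [TopologicalSpace M] [ChartedSpace C2 M]

theorem LocalFlow.contMDiffAt {X : Π x : M, TangentSpace 𝓘(ℂ, C2) x} (φ : LocalFlow X)
    {t : ℂ} {x : M} (h : (t, x) ∈ φ.domain) :
    ContMDiffAt (𝓘(ℂ, ℂ).prod 𝓘(ℂ, C2)) 𝓘(ℂ, C2) ω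
      (fun p : ℂ × M => φ.toFun p.1 p.2) (t, x) :=
  (φ.holomorphic _ h).contMDiffAt (φ.isOpen_domain.mem_nhds h)

theorem LocalFlow.continuousAt {X : Π x : M, TangentSpace 𝓘(ℂ, C2) x} (φ : LocalFlow X)
    {t : ℂ} {x : M} (h : (t, x) ∈ φ.domain) :
    ContinuousAt (fun p : ℂ × M => φ.toFun p.1 p.2) (t, x) :=
  (φ.contMDiffAt h).continuousAt

/-- The generator of a local flow is holomorphic, as the time derivative of a holomorphic map. -/
theorem LocalFlow.isHolomorphicVectorField [IsManifold 𝓘(ℂ, C2) ω M]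
    {X : Π x : M, TangentSpace 𝓘(ℂ, C2) x} (φ : LocalFlow X) : IsHolomorphicVectorField X := by
  intro x
  have hX : X = fun y : M =>
      (mfderiv 𝓘(ℂ, ℂ) 𝓘(ℂ, C2) (fun s : ℂ => φ.toFun s y) 0 (1 : ℂ) : C2) := by
    funext y
    have h := (φ.velocity 0 y (φ.zero_mem y)).mfderiv
    have h' := congrArg (fun A : ℂ →L[ℂ] C2 => A (1 : ℂ)) h
    refine Eq.trans ?_ h'.symm
    -- The velocity at time `0` is based at `φ.toFun 0 y`, which equals `y` only propositionally;
    -- generalizing the base point avoids a cast.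
    have hs : ∀ z : M, z = y → (X y : C2) = ((1 : ℂ) • (X z : C2) : C2) := by
      rintro z rfl
      exact (one_smul ℂ _).symm
    exact hs _ (φ.map_zero y)
  have h0 := φ.contMDiffAt (φ.zero_mem x)
  have hsw : ContMDiffAt (𝓘(ℂ, C2).prod 𝓘(ℂ, ℂ)) 𝓘(ℂ, C2) ω
      (Function.uncurry (fun (y : M) (s : ℂ) => φ.toFun s y)) (x, (0 : ℂ)) :=
    ContMDiffAt.comp (x, (0 : ℂ)) (g := fun p : ℂ × M => φ.toFun p.1 p.2)
      (f := fun p : M × ℂ => (p.2, p.1)) h0 (contMDiffAt_snd.prodMk contMDiffAt_fst)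
  have hd := ContMDiffAt.mfderiv (m := ω) (fun (y : M) (s : ℂ) => φ.toFun s y)
    (fun _ : M => (0 : ℂ)) hsw contMDiffAt_const le_rfl
  rw [contMDiffAt_section]
  refine (hd.clm_apply (contMDiffAt_const (c := (1 : ℂ)))).congr_of_eventuallyEq ?_
  filter_upwards [(chartAt C2 x).open_source.mem_nhds (mem_chart_source C2 x)] with y hy
  -- The parametric derivative `hd` is written in fixed charts. It differs from the time derivative
  -- by a transition map of `ℂ`, which fixes `1`, and by the transition map of `M` that also defines
  -- the trivialization of the tangent bundle at `x`.
  have hin := inTangentCoordinates_eq (I := 𝓘(ℂ, ℂ)) (I' := 𝓘(ℂ, C2)) (fun _ : M => (0 : ℂ))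
    (fun y : M => φ.toFun 0 y)
    (fun y => (mfderiv 𝓘(ℂ, ℂ) 𝓘(ℂ, C2) (fun s : ℂ => φ.toFun s y) 0 : ℂ →L[ℂ] C2))
    (x₀ := x) (x := y) (by simp) (by simpa [φ.map_zero] using hy)
  refine Eq.trans ?_ (congrArg (fun A : ℂ →L[ℂ] C2 => A (1 : ℂ)) hin.symm)
  have h1 : (tangentBundleCore 𝓘(ℂ, ℂ) ℂ).coordChange (achart ℂ (0 : ℂ)) (achart ℂ (0 : ℂ)) 0
      (1 : ℂ) = (1 : ℂ) :=
    (tangentBundleCore 𝓘(ℂ, ℂ) ℂ).coordChange_self _ _ (by simp) _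
  refine Eq.trans ?_ (congrArg (fun u : ℂ =>
    (tangentBundleCore 𝓘(ℂ, C2) M).coordChange (achart C2 (φ.toFun 0 y))
      (achart C2 (φ.toFun 0 x)) (φ.toFun 0 y) ((mfderiv 𝓘(ℂ, ℂ) 𝓘(ℂ, C2)
        (fun s : ℂ => φ.toFun s y) 0 : ℂ →L[ℂ] C2) u)) h1.symm)
  have h2 : ((mfderiv 𝓘(ℂ, ℂ) 𝓘(ℂ, C2) (fun s : ℂ => φ.toFun s y) 0 : ℂ →L[ℂ] C2) (1 : ℂ)) = X y :=
    (congrFun hX y).symm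
  rw [h2]
  simp only [φ.map_zero]
  rfl

end LocalFlow

/-! ### Descent of a local flow along a map with local sections. -/

section Quotient

variable {E B : Type*} [TopologicalSpace B] [ChartedSpace C2 B]

/-- A family of partial maps `Φ_t` of a set `E` that descends along `p : E → B` to germs of a
flow, in terms of local sections of `p`. -/
structure DescendingFlow (p : E → B) where
  dom : Set (ℂ × E)
  flow : ℂ → E → E
  surj : Function.Surjective p
  zero_mem : ∀ e, ((0 : ℂ), e) ∈ dom
  star_mem : ∀ (t : ℂ) (e : E), (t, e) ∈ dom →
    ∀ r : ℝ, 0 ≤ r → r ≤ 1 → ((r : ℂ) * t, e) ∈ dom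
  map_zero : ∀ e, p (flow 0 e) = p e
  germ : ∀ e e' : E, p e = p e' → ∀ᶠ h : ℂ in 𝓝 0, p (flow h e) = p (flow h e')
  section_exists : ∀ (t : ℂ) (e : E), (t, e) ∈ dom → ∃ c : B → E, c (p e) = e ∧
    (∀ᶠ b in 𝓝 (p e), p (c b) = b) ∧
    (∀ᶠ q : ℂ × B in 𝓝 (t, p e), (q.1, c q.2) ∈ dom) ∧
    ContMDiffAt (𝓘(ℂ, ℂ).prod 𝓘(ℂ, C2)) 𝓘(ℂ, C2) ω
      (fun q : ℂ × B => p (flow q.1 (c q.2))) (t, p e) ∧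
    ∀ᶠ q : ℂ × (ℂ × B) in 𝓝 ((0 : ℂ), (t, p e)),
      (q.1, flow q.2.1 (c q.2.2)) ∈ dom ∧
      p (flow (q.2.1 + q.1) (c q.2.2)) = p (flow q.1 (flow q.2.1 (c q.2.2)))

namespace DescendingFlow

variable {p : E → B} (Φ : DescendingFlow p)

theorem eventually_mem {t : ℂ} {e : E} (h : (t, e) ∈ Φ.dom) :
    ∀ᶠ s in 𝓝 t, (s, e) ∈ Φ.dom := by
  obtain ⟨c, hc, -, h1, -⟩ := Φ.section_exists t e h
  have hcont : Tendsto (fun s : ℂ => (s, p e)) (𝓝 t) (𝓝 (t, p e)) :=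
    (Continuous.prodMk_left (p e)).tendsto t
  filter_upwards [hcont.eventually h1] with s hs
  rwa [hc] at hs

theorem contMDiffAt_time {t : ℂ} {e : E} (h : (t, e) ∈ Φ.dom) :
    ContMDiffAt 𝓘(ℂ, ℂ) 𝓘(ℂ, C2) ω (fun s => p (Φ.flow s e)) t := by
  obtain ⟨c, hc, -, -, h1, -⟩ := Φ.section_exists t e h
  have := ContMDiffAt.comp t (f := fun s : ℂ => (s, p e)) h1
    (contMDiffAt_id.prodMk contMDiffAt_const)
  simpa [Function.comp_def, hc] using this

theorem eventually_add {t : ℂ} {e : E} (h : (t, e) ∈ Φ.dom) :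
    ∀ᶠ u : ℂ in 𝓝 0, p (Φ.flow (t + u) e) = p (Φ.flow u (Φ.flow t e)) := by
  obtain ⟨c, hc, -, -, -, h1⟩ := Φ.section_exists t e h
  have hcont : Tendsto (fun u : ℂ => (u, (t, p e))) (𝓝 0) (𝓝 ((0 : ℂ), (t, p e))) :=
    (Continuous.prodMk_left (t, p e)).tendsto 0
  filter_upwards [hcont.eventually h1] with u hu
  simpa [hc] using hu.2

/-- The germ condition is applied to the two points reached at time `t`, and the local flow law
moves the result from time `0` to time `t`. This is the openness half of `flow_eq`. -/
theorem eventually_eq_of_eq {t : ℂ} {e e' : E} (h : (t, e) ∈ Φ.dom) (h' : (t, e') ∈ Φ.dom)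
    (heq : p (Φ.flow t e) = p (Φ.flow t e')) :
    ∀ᶠ s in 𝓝 t, p (Φ.flow s e) = p (Φ.flow s e') := by
  have key : ∀ᶠ u : ℂ in 𝓝 0, p (Φ.flow (t + u) e) = p (Φ.flow (t + u) e') := by
    filter_upwards [Φ.eventually_add h, Φ.eventually_add h', Φ.germ _ _ heq] with u h1 h2 h3
    rw [h1, h2, h3]
  have hcont : Tendsto (fun s : ℂ => s - t) (𝓝 t) (𝓝 0) := by
    have : ContinuousAt (fun s : ℂ => s - t) t := by fun_prop
    simpa [ContinuousAt] using this
  filter_upwards [hcont.eventually key] with s hs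
  simpa using hs

/-- The generator of the flow induced on the base. -/
noncomputable def generator (b : B) : TangentSpace 𝓘(ℂ, C2) b :=
  (mfderiv 𝓘(ℂ, ℂ) 𝓘(ℂ, C2) (fun s : ℂ => p (Φ.flow s (Φ.surj b).choose)) 0 (1 : ℂ) : C2)

/-- The germ condition makes the initial velocity independent of the point chosen in the fibre. -/
theorem hasMFDerivAt_zero (e : E) :
    HasMFDerivAt 𝓘(ℂ, ℂ) 𝓘(ℂ, C2) (fun s : ℂ => p (Φ.flow s e)) 0
      ((1 : ℂ →L[ℂ] ℂ).smulRight (Φ.generator (p e) : C2)) := by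
  have hd := ((Φ.contMDiffAt_time (Φ.zero_mem e)).mdifferentiableAt (by simp)).hasMFDerivAt
  have hg := Φ.germ _ _ (Φ.surj (p e)).choose_spec
  have h1 : mfderiv 𝓘(ℂ, ℂ) 𝓘(ℂ, C2) (fun s : ℂ => p (Φ.flow s (Φ.surj (p e)).choose)) 0 =
      mfderiv 𝓘(ℂ, ℂ) 𝓘(ℂ, C2) (fun s : ℂ => p (Φ.flow s e)) 0 :=
    Filter.EventuallyEq.mfderiv_eq hg
  have h2 : ∀ A : ℂ →L[ℂ] C2, (1 : ℂ →L[ℂ] ℂ).smulRight (A 1) = A := fun A => by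
    ext1
    simp
  exact ((h2 _).trans h1).symm ▸ hd

theorem hasMFDerivAt {t : ℂ} {e : E} (h : (t, e) ∈ Φ.dom) :
    HasMFDerivAt 𝓘(ℂ, ℂ) 𝓘(ℂ, C2) (fun s : ℂ => p (Φ.flow s e)) t
      ((1 : ℂ →L[ℂ] ℂ).smulRight (Φ.generator (p (Φ.flow t e)) : C2)) := by
  let σ : ℂ → ℂ := fun s => s - t
  have hσ : σ t = 0 := sub_self t
  have hsub : HasMFDerivAt 𝓘(ℂ, ℂ) 𝓘(ℂ, ℂ) σ t (ContinuousLinearMap.id ℂ ℂ) :=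
    ((hasFDerivAt_id t).sub_const t).hasMFDerivAt
  have h0 := Φ.hasMFDerivAt_zero (Φ.flow t e)
  have h0' : HasMFDerivAt 𝓘(ℂ, ℂ) 𝓘(ℂ, C2) (fun s : ℂ => p (Φ.flow s (Φ.flow t e)))
      (σ t)
      ((1 : ℂ →L[ℂ] ℂ).smulRight (Φ.generator (p (Φ.flow t e)) : C2)) := by
    rw [hσ]
    exact h0
  have hcomp := HasMFDerivAt.comp t h0' hsub
  refine (hcomp.congr_of_eventuallyEq ?_)
  have hcont : Tendsto (fun s : ℂ => s - t) (𝓝 t) (𝓝 0) := by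
    have : ContinuousAt (fun s : ℂ => s - t) t := by fun_prop
    simpa [ContinuousAt] using this
  filter_upwards [hcont.eventually (Φ.eventually_add h)] with s hs
  simpa [σ] using hs

variable [T2Space B]

/-- Two points of one fibre of `p` have the same image under the flow, as long as both are
defined. -/
theorem flow_eq {t : ℂ} {e e' : E} (h : (t, e) ∈ Φ.dom) (h' : (t, e') ∈ Φ.dom)
    (heq : p e = p e') : p (Φ.flow t e) = p (Φ.flow t e') := by
  let K : Set (Icc (0 : ℝ) 1) :=
    {r | p (Φ.flow (((r : ℝ) : ℂ) * t) e) = p (Φ.flow (((r : ℝ) : ℂ) * t) e')}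
  have hpath : Continuous (fun r : Icc (0 : ℝ) 1 => ((r : ℝ) : ℂ) * t) := by fun_prop
  have hm : ∀ r : Icc (0 : ℝ) 1, (((r : ℝ) : ℂ) * t, e) ∈ Φ.dom :=
    fun r => Φ.star_mem t e h r r.2.1 r.2.2
  have hm' : ∀ r : Icc (0 : ℝ) 1, (((r : ℝ) : ℂ) * t, e') ∈ Φ.dom :=
    fun r => Φ.star_mem t e' h' r r.2.1 r.2.2
  have hc : ∀ {f : E}, (∀ r : Icc (0 : ℝ) 1, (((r : ℝ) : ℂ) * t, f) ∈ Φ.dom) →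
      Continuous (fun r : Icc (0 : ℝ) 1 => p (Φ.flow (((r : ℝ) : ℂ) * t) f)) := fun hf =>
    continuous_iff_continuousAt.2 fun r =>
      ContinuousAt.comp (f := fun r : Icc (0 : ℝ) 1 => ((r : ℝ) : ℂ) * t)
        (Φ.contMDiffAt_time (hf r)).continuousAt hpath.continuousAt
  -- Closedness uses that `B` is Hausdorff, openness is `eventually_eq_of_eq`; connectedness of the
  -- interval then leads from `0` to `1`.
  have hK : IsClopen K := by
    refine ⟨isClosed_eq (hc hm) (hc hm'), isOpen_iff_mem_nhds.2 fun r hr => ?_⟩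
    exact hpath.continuousAt.eventually (Φ.eventually_eq_of_eq (hm r) (hm' r) hr)
  have h0 : (⟨0, by simp⟩ : Icc (0 : ℝ) 1) ∈ K := by
    simp [K, Φ.map_zero, heq]
  have h1 : (⟨1, by simp⟩ : Icc (0 : ℝ) 1) ∈ K := by
    rw [hK.eq_univ ⟨_, h0⟩]
    trivial
  simpa [K] using h1

open Classical in
/-- The flow induced on the base. -/
noncomputable def baseFlow (t : ℂ) (b : B) : B :=
  if h : ∃ e, p e = b ∧ (t, e) ∈ Φ.dom then p (Φ.flow t h.choose) else b

/-- By `flow_eq` the choice of a point over `b` does not matter. -/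
theorem baseFlow_apply {t : ℂ} {e : E} (h : (t, e) ∈ Φ.dom) :
    Φ.baseFlow t (p e) = p (Φ.flow t e) := by
  have hex : ∃ e', p e' = p e ∧ (t, e') ∈ Φ.dom := ⟨e, rfl, h⟩
  rw [baseFlow, dif_pos hex]
  exact Φ.flow_eq hex.choose_spec.2 h hex.choose_spec.1

/-- The local flow induced on the base. -/
noncomputable def localFlow : LocalFlow Φ.generator where
  domain := {q | ∃ e, p e = q.2 ∧ (q.1, e) ∈ Φ.dom}
  isOpen_domain := by
    refine isOpen_iff_mem_nhds.2 ?_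
    rintro ⟨t, b⟩ ⟨e, rfl, he⟩
    obtain ⟨c, -, h1, h2, -⟩ := Φ.section_exists t e he
    filter_upwards [continuousAt_snd.eventually h1, h2] with q hq1 hq2
    exact ⟨c q.2, hq1, hq2⟩
  zero_mem b := ⟨(Φ.surj b).choose, (Φ.surj b).choose_spec, Φ.zero_mem _⟩
  star_mem := by
    rintro t b ⟨e, rfl, he⟩ r h0 h1
    exact ⟨e, rfl, Φ.star_mem t e he r h0 h1⟩
  toFun := Φ.baseFlow
  holomorphic := by
    rintro ⟨t, b⟩ ⟨e, rfl, he⟩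
    obtain ⟨c, -, h1, h2, h3, -⟩ := Φ.section_exists t e he
    refine (h3.congr_of_eventuallyEq ?_).contMDiffWithinAt
    filter_upwards [continuousAt_snd.eventually h1, h2] with q hq1 hq2
    rw [← Φ.baseFlow_apply hq2]
    congr 1
    exact hq1.symm
  map_zero b := by
    obtain ⟨e, rfl⟩ := Φ.surj b
    rw [Φ.baseFlow_apply (Φ.zero_mem e), Φ.map_zero]
  velocity := by
    rintro t b ⟨e, rfl, he⟩
    have he' : (t, e) ∈ Φ.dom := he
    have h := Φ.hasMFDerivAt he'
    have heq : (fun s : ℂ => Φ.baseFlow s (p e)) =ᶠ[𝓝 t] fun s => p (Φ.flow s e) := by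
      filter_upwards [Φ.eventually_mem he'] with s hs
      exact Φ.baseFlow_apply hs
    have h' := h.congr_of_eventuallyEq heq
    have hcast : ∀ z : B, z = p (Φ.flow t e) →
        (1 : ℂ →L[ℂ] ℂ).smulRight (Φ.generator z : C2) =
        (1 : ℂ →L[ℂ] ℂ).smulRight (Φ.generator (p (Φ.flow t e)) : C2) := by
      rintro z rfl
      rfl
    exact (hcast _ (Φ.baseFlow_apply he')).symm ▸ h'
  map_add := by
    rintro t b ⟨e, rfl, he⟩
    obtain ⟨c, -, h1, h2, -, h3⟩ := Φ.section_exists t e he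
    have hc1 : Tendsto (fun q : ℂ × (ℂ × B) => q.2.2) (𝓝 ((0 : ℂ), (t, p e))) (𝓝 (p e)) :=
      (continuous_snd.comp continuous_snd).tendsto ((0 : ℂ), (t, p e))
    have hc2 : Tendsto (fun q : ℂ × (ℂ × B) => q.2) (𝓝 ((0 : ℂ), (t, p e))) (𝓝 (t, p e)) :=
      continuous_snd.tendsto ((0 : ℂ), (t, p e))
    have hc3 : Tendsto (fun q : ℂ × (ℂ × B) => (q.2.1 + q.1, q.2.2)) (𝓝 ((0 : ℂ), (t, p e)))
        (𝓝 (t, p e)) := by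
      have : Continuous (fun q : ℂ × (ℂ × B) => (q.2.1 + q.1, q.2.2)) := by fun_prop
      simpa using this.tendsto ((0 : ℂ), (t, p e))
    filter_upwards [hc1.eventually h1, hc2.eventually h2, hc3.eventually h2, h3]
      with q hq1 hq2 hq3 hq4
    have ha := Φ.baseFlow_apply hq2
    have hb := Φ.baseFlow_apply hq3
    have hd := Φ.baseFlow_apply hq4.1
    rw [hq1] at ha
    simp only [hq1] at hb
    rw [hb, ha, hd, hq4.2]

end DescendingFlow

end Quotient

end CartanGluing

/-! ### The maps induced on the associated bundle. -/

namespace CartanGluing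

theorem HolRep.ext_mul (ρ : HolRep) {A B : C2 →L[ℂ] C2} (hA : IsUnit A) (hB : IsUnit B) :
    ρ.ext (A * B) = ρ.ext A * ρ.ext B := by
  obtain ⟨a, rfl⟩ := hA
  obtain ⟨b, rfl⟩ := hB
  rw [← Units.val_mul, ρ.ext_unit, ρ.ext_unit, ρ.ext_unit, map_mul, Units.val_mul]

theorem HolRep.ext_one (ρ : HolRep) : ρ.ext 1 = 1 := by
  have := ρ.ext_unit 1
  simpa using this

theorem HolRep.ext_of_not_isUnit (ρ : HolRep) {A : C2 →L[ℂ] C2} (hA : ¬ IsUnit A) :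
    ρ.ext A = 0 := dif_neg hA

section Jacobian

variable {M : Type*} [TopologicalSpace M] [ChartedSpace C2 M]
  {X : Π x : M, TangentSpace 𝓘(ℂ, C2) x}

/-- The Jacobian of `φ_t` at `x` in the preferred charts. -/
noncomputable def LocalFlow.jac (φ : LocalFlow X) (t : ℂ) (x : M) : C2 →L[ℂ] C2 :=
  mfderiv 𝓘(ℂ, C2) 𝓘(ℂ, C2) (φ.toFun t) x

theorem LocalFlow.mdifferentiableAt (φ : LocalFlow X) {t : ℂ} {x : M} (h : (t, x) ∈ φ.domain) :
    MDifferentiableAt 𝓘(ℂ, C2) 𝓘(ℂ, C2) (φ.toFun t) x := by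
  have h1 : ContMDiffAt 𝓘(ℂ, C2) 𝓘(ℂ, C2) ω (φ.toFun t) x :=
    ContMDiffAt.comp x (g := fun p : ℂ × M => φ.toFun p.1 p.2) (f := fun y : M => (t, y))
      (φ.contMDiffAt h) (contMDiffAt_const.prodMk contMDiffAt_id)
  exact h1.mdifferentiableAt (by simp)

theorem LocalFlow.continuousAt_toFun (φ : LocalFlow X) {t : ℂ} {x : M} (h : (t, x) ∈ φ.domain) :
    ContinuousAt (φ.toFun t) x :=
  (φ.mdifferentiableAt h).continuousAt

/-- The chain rule; the composition law is needed on a neighbourhood of `x`, since it is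
differentiated. -/
theorem LocalFlow.jac_mul (φ : LocalFlow X) {a b c : ℂ} {x : M} (hc : (c, x) ∈ φ.domain)
    (hb : (b, φ.toFun c x) ∈ φ.domain)
    (h : ∀ᶠ y in 𝓝 x, φ.toFun a y = φ.toFun b (φ.toFun c y)) :
    φ.jac a x = φ.jac b (φ.toFun c x) * φ.jac c x := by
  have h1 : mfderiv 𝓘(ℂ, C2) 𝓘(ℂ, C2) (φ.toFun a) x =
      mfderiv 𝓘(ℂ, C2) 𝓘(ℂ, C2) (φ.toFun b ∘ φ.toFun c) x := Filter.EventuallyEq.mfderiv_eq h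
  exact h1.trans (mfderiv_comp x (φ.mdifferentiableAt hb) (φ.mdifferentiableAt hc))

theorem LocalFlow.jac_zero (φ : LocalFlow X) (x : M) : φ.jac 0 x = 1 := by
  have h : φ.toFun 0 = id := funext φ.map_zero
  rw [LocalFlow.jac, h]
  exact mfderiv_id

end Jacobian

section Push

variable {S : Type*} [TopologicalSpace S] [ChartedSpace C2 S] [IsManifold 𝓘(ℂ, C2) ω S]
  {ρ : HolRep} {X : Π x : S, TangentSpace 𝓘(ℂ, C2) x}

/-- The map induced by a local flow on the total space of the associated bundle. -/
noncomputable def pushTot (φ : LocalFlow X) (t : ℂ) (u : TotV S ρ) : TotV S ρ :=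
  ⟨φ.toFun t u.1, push ρ φ t u.1 u.2⟩

theorem push_add (φ : LocalFlow X) (t : ℂ) (x : S) (v w : V ρ x) :
    push ρ φ t x (v + w) = push ρ φ t x v + push ρ φ t x w :=
  map_add (ρ.ext (φ.jac t x)) (v : C4) (w : C4)

theorem push_smul (φ : LocalFlow X) (t : ℂ) (x : S) (c : ℂ) (v : V ρ x) :
    push ρ φ t x (c • v) = c • push ρ φ t x v :=
  map_smul (ρ.ext (φ.jac t x)) c (v : C4)

/-- The induced map on a fibre, as a linear map. -/
noncomputable def pushₗ (ρ : HolRep) (φ : LocalFlow X) (t : ℂ) (x : S) :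
    V ρ x →ₗ[ℂ] V ρ (φ.toFun t x) where
  toFun := push ρ φ t x
  map_add' := push_add φ t x
  map_smul' := push_smul φ t x

theorem pushₗ_apply (φ : LocalFlow X) (t : ℂ) (x : S) (v : V ρ x) :
    pushₗ ρ φ t x v = push ρ φ t x v := rfl

/-- `push` uses preferred charts that may jump with the point. Conjugating the Jacobian by
transition maps expresses it in charts fixed near `u.1` and its image, where it is holomorphic in
all variables; multiplicativity of `ρ` turns this into the coordinate expression of `pushTot`. -/
theorem contMDiffAt_pushTot (φ : LocalFlow X) {t : ℂ} {u : TotV S ρ} (h : (t, u.1) ∈ φ.domain)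
    (hu : IsUnit (φ.jac t u.1))
    (hu' : ∀ᶠ q : ℂ × TotV S ρ in 𝓝 (t, u),
      IsUnit (φ.jac q.1 q.2.1)) :
    ContMDiffAt (𝓘(ℂ, ℂ).prod (𝓘(ℂ, C2).prod 𝓘(ℂ, C4))) (𝓘(ℂ, C2).prod 𝓘(ℂ, C4)) ω
      (fun q : ℂ × TotV S ρ => pushTot φ q.1 q.2) (t, u) := by
  have hproj : ContMDiffAt (𝓘(ℂ, ℂ).prod (𝓘(ℂ, C2).prod 𝓘(ℂ, C4))) 𝓘(ℂ, C2) ω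
      (fun q : ℂ × TotV S ρ => q.2.1) (t, u) :=
    ContMDiffAt.comp (t, u) (g := fun w : TotV S ρ => w.1) (f := fun q : ℂ × TotV S ρ => q.2)
      (contMDiffAt_proj (fun x : S => V ρ x)) contMDiffAt_snd
  have hbase : ContMDiffAt (𝓘(ℂ, ℂ).prod (𝓘(ℂ, C2).prod 𝓘(ℂ, C4))) 𝓘(ℂ, C2) ω
      (fun q : ℂ × TotV S ρ => φ.toFun q.1 q.2.1) (t, u) :=
    ContMDiffAt.comp (t, u) (g := fun p : ℂ × S => φ.toFun p.1 p.2)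
      (f := fun q : ℂ × TotV S ρ => (q.1, q.2.1)) (φ.contMDiffAt h)
      (contMDiffAt_fst.prodMk hproj)
  rw [contMDiffAt_totalSpace]
  refine ⟨hbase, ?_⟩
  have hf : ContMDiffAt ((𝓘(ℂ, ℂ).prod (𝓘(ℂ, C2).prod 𝓘(ℂ, C4))).prod 𝓘(ℂ, C2)) 𝓘(ℂ, C2) ω
      (Function.uncurry (fun (q : ℂ × TotV S ρ) (y : S) => φ.toFun q.1 y)) ((t, u), u.1) :=
    ContMDiffAt.comp ((t, u), u.1) (g := fun p : ℂ × S => φ.toFun p.1 p.2)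
      (f := fun q : (ℂ × TotV S ρ) × S => (q.1.1, q.2)) (φ.contMDiffAt h)
      ((contMDiffAt_fst.comp _ contMDiffAt_fst).prodMk contMDiffAt_snd)
  have hd := ContMDiffAt.mfderiv (m := ω) (fun (q : ℂ × TotV S ρ) (y : S) => φ.toFun q.1 y)
    (fun q : ℂ × TotV S ρ => q.2.1) hf hproj le_rfl
  let J : ℂ × TotV S ρ → C2 →L[ℂ] C2 :=
    fun q => φ.jac q.1 q.2.1
  let Z := tangentBundleCore 𝓘(ℂ, C2) S
  have hin : ∀ᶠ q : ℂ × TotV S ρ in 𝓝 (t, u),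
      q.2.1 ∈ (chartAt C2 u.1).source ∧
      φ.toFun q.1 q.2.1 ∈ (chartAt C2 (φ.toFun t u.1)).source :=
    (hproj.continuousAt.eventually
      ((chartAt C2 u.1).open_source.mem_nhds (mem_chart_source C2 u.1))).and
    (hbase.continuousAt.eventually
      ((chartAt C2 (φ.toFun t u.1)).open_source.mem_nhds (mem_chart_source C2 _)))
  have heq : ∀ q : ℂ × TotV S ρ, q.2.1 ∈ (chartAt C2 u.1).source →
      φ.toFun q.1 q.2.1 ∈ (chartAt C2 (φ.toFun t u.1)).source →
      inTangentCoordinates 𝓘(ℂ, C2) 𝓘(ℂ, C2) (fun q : ℂ × TotV S ρ => q.2.1)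
        (fun q => φ.toFun q.1 q.2.1) J (t, u) q =
      Z.coordChange (achart C2 (φ.toFun q.1 q.2.1)) (achart C2 (φ.toFun t u.1))
        (φ.toFun q.1 q.2.1) * (J q * Z.coordChange (achart C2 u.1) (achart C2 q.2.1) q.2.1) :=
    fun q h1 h2 => inTangentCoordinates_eq _ _ _ h1 h2
  have hcu : ∀ x y : S, y ∈ (chartAt C2 x).source →
      IsUnit (Z.coordChange (achart C2 y) (achart C2 x) y) ∧
      IsUnit (Z.coordChange (achart C2 x) (achart C2 y) y) := fun x y hy =>
    ⟨isUnit_coordChange S _ _ _ ⟨mem_chart_source C2 y, hy⟩,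
      isUnit_coordChange S _ _ _ ⟨hy, mem_chart_source C2 y⟩⟩
  have hext : ContMDiffAt (𝓘(ℂ, ℂ).prod (𝓘(ℂ, C2).prod 𝓘(ℂ, C4))) 𝓘(ℂ, C4 →L[ℂ] C4) ω
      (fun q => ρ.ext (inTangentCoordinates 𝓘(ℂ, C2) 𝓘(ℂ, C2) (fun q : ℂ × TotV S ρ => q.2.1)
        (fun q => φ.toFun q.1 q.2.1) J (t, u) q)) (t, u) := by
    have hu0 : IsUnit (inTangentCoordinates 𝓘(ℂ, C2) 𝓘(ℂ, C2) (fun q : ℂ × TotV S ρ => q.2.1)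
        (fun q => φ.toFun q.1 q.2.1) J (t, u) (t, u)) := by
      obtain ⟨h1, h2⟩ := hin.self_of_nhds
      rw [heq (t, u) h1 h2]
      exact (hcu _ _ h2).1.mul (hu.mul (hcu _ _ h1).2)
    obtain ⟨a, ha⟩ := hu0
    have h2 := (ρ.contDiffAt_ext a).contMDiffAt
    rw [ha] at h2
    exact ContMDiffAt.comp (g := ρ.ext) (t, u) h2 hd
  have hsnd : ContMDiffAt (𝓘(ℂ, ℂ).prod (𝓘(ℂ, C2).prod 𝓘(ℂ, C4))) 𝓘(ℂ, C4) ω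
      (fun q : ℂ × TotV S ρ => (trivializationAt C4 (fun z : S => V ρ z) u.1 q.2).2) (t, u) :=
    (contMDiffAt_totalSpace.1 (contMDiffAt_snd (I := 𝓘(ℂ, ℂ)) (M := ℂ) (p := (t, u)))).2
  refine (hext.clm_apply hsnd).congr_of_eventuallyEq ?_
  filter_upwards [hin, hu'] with q hq hqu
  obtain ⟨h1, h2⟩ := hq
  rw [heq q h1 h2, ρ.ext_mul (hcu _ _ h2).1 (hqu.mul (hcu _ _ h1).2),
    ρ.ext_mul hqu (hcu _ _ h1).2]
  -- Passing to the fixed chart and back to the preferred one is the identity by the cocycle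
  -- condition.
  have hinv : ρ.ext (Z.coordChange (achart C2 u.1) (achart C2 q.2.1) q.2.1)
      (ρ.ext (Z.coordChange (achart C2 q.2.1) (achart C2 u.1) q.2.1) (q.2.2 : C4)) =
      (q.2.2 : C4) := by
    have hc := (assocCore S ρ).coordChange_comp (achart C2 q.2.1) (achart C2 u.1)
      (achart C2 q.2.1) q.2.1 ⟨⟨mem_chart_source C2 _, h1⟩, mem_chart_source C2 _⟩ (q.2.2 : C4)
    exact hc.trans ((assocCore S ρ).coordChange_self (achart C2 q.2.1) q.2.1
      (mem_chart_source C2 _) _)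
  have := congrArg (fun w : C4 =>
    ρ.ext (Z.coordChange (achart C2 (φ.toFun q.1 q.2.1)) (achart C2 (φ.toFun t u.1))
        (φ.toFun q.1 q.2.1)) (ρ.ext (J q) w)) hinv.symm
  exact this

end Push

end CartanGluing

namespace CartanGluing

/-! ### Functoriality of the induced maps, subbundles, and preservation of `U^±`. -/

variable {S : Type*} [TopologicalSpace S] [ChartedSpace C2 S] [IsManifold 𝓘(ℂ, C2) ω S]
  {ρ : HolRep}

section Functoriality

variable {X : Π x : S, TangentSpace 𝓘(ℂ, C2) x} (φ : LocalFlow X)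

theorem totV_mk_eq {x y : S} (h : x = y) {v w : C4} (hv : v = w) :
    (⟨x, v⟩ : TotV S ρ) = ⟨y, w⟩ := by
  subst h hv
  rfl

theorem pushTot_zero (u : TotV S ρ) : pushTot φ 0 u = u := by
  refine totV_mk_eq (φ.map_zero u.1) ?_
  have : push ρ φ 0 u.1 u.2 = ρ.ext (φ.jac 0 u.1) (u.2 : C4) := rfl
  rw [this, φ.jac_zero, ρ.ext_one]
  rfl

theorem pushTot_pushTot {a b c : ℂ} {u : TotV S ρ} (hc : (c, u.1) ∈ φ.domain)
    (hb : (b, φ.toFun c u.1) ∈ φ.domain)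
    (h : ∀ᶠ y in 𝓝 u.1, φ.toFun a y = φ.toFun b (φ.toFun c y))
    (hcu : IsUnit (φ.jac c u.1)) (hbu : IsUnit (φ.jac b (φ.toFun c u.1))) :
    pushTot φ b (pushTot φ c u) = pushTot φ a u := by
  refine totV_mk_eq h.self_of_nhds.symm ?_
  have h1 : push ρ φ a u.1 u.2 = ρ.ext (φ.jac a u.1) (u.2 : C4) := rfl
  rw [h1, φ.jac_mul hc hb h, ρ.ext_mul hbu hcu]
  rfl

end Functoriality

section Subbundle

theorem IsHolSubbundle.finrank_eq {k : ℕ} {W : Π x : S, Submodule ℂ (V ρ x)}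
    (h : IsHolSubbundle k W) (x : S) : Module.finrank ℂ (W x) = k := by
  obtain ⟨e, -, he⟩ := h x
  obtain ⟨hli, hsp⟩ := he.self_of_nhds
  rw [← hsp, finrank_span_eq_card hli, Fintype.card_fin]

/-- A holomorphic subbundle is a closed subset of the total space. -/
theorem IsHolSubbundle.isClosed {k : ℕ} {W : Π x : S, Submodule ℂ (V ρ x)}
    (h : IsHolSubbundle k W) : IsClosed {u : TotV S ρ | u.2 ∈ W u.1} := by
  rw [← isOpen_compl_iff, isOpen_iff_mem_nhds]
  intro u₀ hu₀
  obtain ⟨e, hol, he⟩ := h u₀.1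
  let T := trivializationAt C4 (fun z : S => V ρ z) u₀.1
  -- A vector lies outside `W` exactly when it is linearly independent of the local frame. In a
  -- trivialization this is independence of `k + 1` vectors depending continuously on `u`, an open
  -- condition.
  let A : TotV S ρ → Fin (k + 1) → C4 := fun u =>
    Fin.cons (α := fun _ => C4) (T u).2 (fun i => (T ⟨u.1, e i u.1⟩).2)
  have hproj : ContinuousAt (fun u : TotV S ρ => u.1) u₀ :=
    (contMDiffAt_proj (IB := 𝓘(ℂ, C2)) (n := ω) (fun x : S => V ρ x)).continuousAt
  have hA : ContinuousAt A u₀ := by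
    refine continuousAt_pi.2 fun i => ?_
    refine Fin.cases ?_ (fun j => ?_) i
    · have hid : ContMDiffAt (𝓘(ℂ, C2).prod 𝓘(ℂ, C4)) (𝓘(ℂ, C2).prod 𝓘(ℂ, C4)) ω
        (fun u : TotV S ρ => u) u₀ := contMDiffAt_id
      exact (contMDiffAt_totalSpace.1 hid).2.continuousAt
    · have hj := (contMDiffAt_totalSpace.1 (hol j)).2.continuousAt
      exact ContinuousAt.comp (f := fun u : TotV S ρ => u.1) hj hproj
  have hlin : ∀ u : TotV S ρ, u.1 ∈ T.baseSet →
      (LinearIndependent ℂ (A u) ↔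
        LinearIndependent ℂ (Fin.cons (α := fun _ => V ρ u.1) u.2 (fun i => e i u.1))) := by
    intro u hu
    let L := T.continuousLinearEquivAt ℂ u.1 hu
    have hL : ∀ v : V ρ u.1, L v = (T ⟨u.1, v⟩).2 := fun v => rfl
    have hcomp : A u = (L : V ρ u.1 →ₗ[ℂ] C4) ∘
        (Fin.cons (α := fun _ => V ρ u.1) u.2 (fun i => e i u.1)) := by
      funext i
      refine Fin.cases ?_ (fun j => ?_) i <;> rfl
    rw [hcomp]
    exact LinearMap.linearIndependent_iff _ (LinearMap.ker_eq_bot.2 L.injective)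
  have hb : T.baseSet ∈ 𝓝 u₀.1 :=
    T.open_baseSet.mem_nhds (FiberBundle.mem_baseSet_trivializationAt' u₀.1)
  have h0 : LinearIndependent ℂ (A u₀) := by
    rw [hlin u₀ (mem_of_mem_nhds hb), linearIndependent_finCons]
    obtain ⟨hli, hsp⟩ := he.self_of_nhds
    exact ⟨hli, by rw [hsp]; exact hu₀⟩
  filter_upwards [hA.eventually (isOpen_setOfPred_linearIndependent.mem_nhds h0),
    hproj.eventually he, hproj.eventually hb] with u hu1 hu2 hu3
  have hu1' : LinearIndependent ℂ (A u) := hu1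
  rw [hlin u hu3, linearIndependent_finCons, hu2.2] at hu1'
  exact hu1'.2

end Subbundle

section Preserved

variable {C : ConformalCartan S ρ} {X : Π x : S, TangentSpace 𝓘(ℂ, C2) x} {φ : LocalFlow X}
  (hφ : C.IsPreservedBy φ) {t : ℂ} {x : S}

include hφ

/-- At a singular Jacobian the junk value makes the induced map zero, which cannot preserve a
nondegenerate form. -/
theorem ConformalCartan.IsPreservedBy.isUnit_jac (h : (t, x) ∈ φ.domain) :
    IsUnit (φ.jac t x) := by
  by_contra hn
  have h0 : ∀ v : V ρ x, push ρ φ t x v = 0 := fun v => by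
    have : push ρ φ t x v = ρ.ext (φ.jac t x) (v : C4) := rfl
    rw [this, ρ.ext_of_not_isUnit hn]
    rfl
  have hz : ∀ v : V ρ x, v = 0 := fun v => C.inner_nondeg x v fun w => by
    rw [← hφ.inner t x h, h0, map_zero, LinearMap.zero_apply]
  obtain ⟨v, hv⟩ := exists_ne (0 : C4)
  exact hv (hz v)

theorem ConformalCartan.IsPreservedBy.push_injective (h : (t, x) ∈ φ.domain) :
    Function.Injective (pushₗ ρ φ t x) := by
  rw [← LinearMap.ker_eq_bot, LinearMap.ker_eq_bot']
  intro v hv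
  refine C.inner_nondeg x v fun w => ?_
  rw [← hφ.inner t x h, ← pushₗ_apply, hv, map_zero, LinearMap.zero_apply]

theorem ConformalCartan.IsPreservedBy.push_ne_zero (h : (t, x) ∈ φ.domain) {v : V ρ x}
    (hv : v ≠ 0) : push ρ φ t x v ≠ 0 := fun h0 =>
  hv (hφ.push_injective h (h0.trans (map_zero (pushₗ ρ φ t x)).symm))

theorem ConformalCartan.IsPreservedBy.contMDiffAt_pushTot {u : TotV S ρ}
    (h : (t, u.1) ∈ φ.domain) :
    ContMDiffAt (𝓘(ℂ, ℂ).prod (𝓘(ℂ, C2).prod 𝓘(ℂ, C4))) (𝓘(ℂ, C2).prod 𝓘(ℂ, C4)) ω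
      (fun q : ℂ × TotV S ρ => pushTot φ q.1 q.2) (t, u) := by
  refine CartanGluing.contMDiffAt_pushTot φ h (hφ.isUnit_jac h) ?_
  have hproj : ContinuousAt (fun u : TotV S ρ => u.1) u :=
    (contMDiffAt_proj (IB := 𝓘(ℂ, C2)) (n := ω) (fun x : S => V ρ x)).continuousAt
  have hc : ContinuousAt (fun q : ℂ × TotV S ρ => (q.1, q.2.1)) (t, u) :=
    continuousAt_fst.prodMk (ContinuousAt.comp (g := fun u : TotV S ρ => u.1)
      (f := fun q : ℂ × TotV S ρ => q.2) hproj continuousAt_snd)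
  filter_upwards [hc.eventually (φ.isOpen_domain.mem_nhds h)] with q hq
  exact hφ.isUnit_jac hq

theorem ConformalCartan.IsPreservedBy.map_L (h : (t, x) ∈ φ.domain) :
    (C.L x).map (pushₗ ρ φ t x) = C.L (φ.toFun t x) := by
  have hle : (C.L x).map (pushₗ ρ φ t x) ≤ C.L (φ.toFun t x) := by
    rintro _ ⟨v, hv, rfl⟩
    exact hφ.line t x h v hv
  have : FiniteDimensional ℂ (V ρ (φ.toFun t x)) := inferInstanceAs (FiniteDimensional ℂ C4)
  refine Submodule.eq_of_le_of_finrank_eq hle ?_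
  rw [← (Submodule.equivMapOfInjective _ (hφ.push_injective h) (C.L x)).finrank_eq,
    C.finrank_L, C.finrank_L]

end Preserved

namespace NullSubbundles

variable {C : ConformalCartan S ρ} (N : NullSubbundles C)
  {X : Π x : S, TangentSpace 𝓘(ℂ, C2) x} {φ : LocalFlow X} (hφ : C.IsPreservedBy φ) {t : ℂ} {x : S}

/-- The opposite label. -/
def _root_.CartanGluing.Side.op : Side → Side
  | .plus => .minus
  | .minus => .plus

theorem inter_op (s : Side) (x : S) : N.U s x ⊓ N.U s.op x = C.L x := by
  cases s
  · exact N.inter x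
  · rw [inf_comm]
    exact N.inter x

theorem mem_or_mem_op_iff (s : Side) (x : S) (a : V ρ x) : (a ∈ N.U s x ∨ a ∈ N.U s.op x) ↔
    (∀ l ∈ C.L x, C.inner x a l = 0) ∧ C.inner x a a = 0 := by
  cases s
  · exact N.mem_iff x a
  · rw [or_comm]
    exact N.mem_iff x a

theorem L_le (s : Side) (x : S) : C.L x ≤ N.U s x := by
  rw [← N.inter_op s x]
  exact inf_le_left

include hφ

/-- The image of `U^±` consists of null vectors of `Λ^⊥`, and a subspace contained in a union of two
subspaces lies in one of them. -/
theorem map_U_le_or (s : Side) (h : (t, x) ∈ φ.domain) :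
    (N.U s x).map (pushₗ ρ φ t x) ≤ N.U s (φ.toFun t x) ∨
      (N.U s x).map (pushₗ ρ φ t x) ≤ N.U s.op (φ.toFun t x) := by
  have hsub : ((N.U s x).map (pushₗ ρ φ t x) : Set (V ρ (φ.toFun t x))) ⊆
      N.U s (φ.toFun t x) ∪ N.U s.op (φ.toFun t x) := by
    rintro _ ⟨v, hv, rfl⟩
    obtain ⟨h1, h2⟩ := (N.mem_or_mem_op_iff s x v).1 (Or.inl hv)
    refine (N.mem_or_mem_op_iff s _ _).2 ⟨fun l hl => ?_, ?_⟩
    · rw [← hφ.map_L h] at hl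
      obtain ⟨l₀, hl₀, rfl⟩ := hl
      exact (hφ.inner t x h v l₀).trans (h1 l₀ hl₀)
    · exact (hφ.inner t x h v v).trans h2
  by_contra hcon
  rw [not_or, SetLike.not_le_iff_exists, SetLike.not_le_iff_exists] at hcon
  obtain ⟨⟨a, ha, ha'⟩, b, hb, hb'⟩ := hcon
  have ha2 := (hsub ha).resolve_left ha'
  have hb2 := (hsub hb).resolve_right hb'
  rcases hsub (Submodule.add_mem _ ha hb) with hab | hab
  · exact ha' ((Submodule.add_mem_iff_left _ hb2).1 hab)
  · exact hb' ((Submodule.add_mem_iff_right _ ha2).1 hab)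

/-- A local flow that preserves the Cartan connection preserves each of the bundles `U^±`. -/
theorem push_mem_U (s : Side) (h : (t, x) ∈ φ.domain) {v : V ρ x} (hv : v ∈ N.U s x) :
    push ρ φ t x v ∈ N.U s (φ.toFun t x) := by
  let K : Side → Set (Icc (0 : ℝ) 1) := fun s' =>
    {r | (N.U s x).map (pushₗ ρ φ (((r : ℝ) : ℂ) * t) x) ≤
      N.U s' (φ.toFun (((r : ℝ) : ℂ) * t) x)}
  have hm : ∀ r : Icc (0 : ℝ) 1, (((r : ℝ) : ℂ) * t, x) ∈ φ.domain :=
    fun r => φ.star_mem t x h r r.2.1 r.2.2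
  have hpath : Continuous (fun r : Icc (0 : ℝ) 1 => ((r : ℝ) : ℂ) * t) := by fun_prop
  have hcont : ∀ v : V ρ x, Continuous
      (fun r : Icc (0 : ℝ) 1 => pushTot φ (((r : ℝ) : ℂ) * t) (⟨x, v⟩ : TotV S ρ)) := fun v =>
    continuous_iff_continuousAt.2 fun r =>
      ContinuousAt.comp (g := fun q : ℂ × TotV S ρ => pushTot φ q.1 q.2)
        (f := fun r : Icc (0 : ℝ) 1 => (((r : ℝ) : ℂ) * t, (⟨x, v⟩ : TotV S ρ)))
        (hφ.contMDiffAt_pushTot (hm r)).continuousAt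
        (hpath.continuousAt.prodMk continuousAt_const)
  have hclosed : ∀ s', IsClosed (K s') := fun s' => by
    have hK : K s' = ⋂ v ∈ N.U s x,
        (fun r : Icc (0 : ℝ) 1 => pushTot φ (((r : ℝ) : ℂ) * t) (⟨x, v⟩ : TotV S ρ)) ⁻¹'
          {u : TotV S ρ | u.2 ∈ N.U s' u.1} := by
      ext r
      simp only [mem_iInter]
      exact Submodule.map_le_iff_le_comap
    rw [hK]
    exact isClosed_biInter fun v _ => (N.holomorphic s').isClosed.preimage (hcont v)
  -- The two closed sets cover the interval by `map_U_le_or`. They are disjoint, as otherwise a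
  -- space of dimension two would lie in the line `Λ`.
  have hcompl : (K s)ᶜ = K s.op := by
    ext r
    refine ⟨fun hr => (N.map_U_le_or hφ s (hm r)).resolve_left hr, fun hr hr' => ?_⟩
    have hle : (N.U s x).map (pushₗ ρ φ (((r : ℝ) : ℂ) * t) x) ≤ C.L _ := by
      rw [← N.inter_op s]
      exact le_inf hr' hr
    have : FiniteDimensional ℂ (V ρ (φ.toFun (((r : ℝ) : ℂ) * t) x)) :=
      inferInstanceAs (FiniteDimensional ℂ C4)
    have hfr := Submodule.finrank_mono hle
    rw [← (Submodule.equivMapOfInjective _ (hφ.push_injective (hm r)) (N.U s x)).finrank_eq,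
      C.finrank_L,
      (N.holomorphic s).finrank_eq] at hfr
    omega
  have hclopen : IsClopen (K s) := ⟨hclosed s, by rw [← isClosed_compl_iff, hcompl]; exact hclosed _⟩
  have h0 : (⟨0, by simp⟩ : Icc (0 : ℝ) 1) ∈ K s := by
    rintro _ ⟨w, hw, rfl⟩
    have hz := pushTot_zero φ (⟨x, w⟩ : TotV S ρ)
    have : (pushTot φ (((0 : ℝ) : ℂ) * t) (⟨x, w⟩ : TotV S ρ)) ∈
        {u : TotV S ρ | u.2 ∈ N.U s u.1} := by
      rw [Complex.ofReal_zero, zero_mul, hz]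
      exact hw
    exact this
  have h1 : (⟨1, by simp⟩ : Icc (0 : ℝ) 1) ∈ K s := by
    rw [hclopen.eq_univ ⟨_, h0⟩]
    trivial
  have h1' : pushTot φ (((1 : ℝ) : ℂ) * t) (⟨x, v⟩ : TotV S ρ) ∈
      {u : TotV S ρ | u.2 ∈ N.U s u.1} := h1 ⟨v, hv, rfl⟩
  rw [Complex.ofReal_one, one_mul] at h1'
  exact h1'

end NullSubbundles

end CartanGluing

/-! ### Local inverses of the flow and transport of sections. -/

namespace CartanGluing

section Germs

variable {M : Type*} [TopologicalSpace M] [ChartedSpace C2 M]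
  {X : Π x : M, TangentSpace 𝓘(ℂ, C2) x}

/-- The flow law is upgraded from points to germs in the space variable, as differentiation of `φ_t`
requires. -/
theorem LocalFlow.eventually_add (φ : LocalFlow X) {t : ℂ} {x : M} (h : (t, x) ∈ φ.domain) :
    ∀ᶠ q : ℂ × (ℂ × M) in 𝓝 ((0 : ℂ), (t, x)),
      (q.2.1, q.2.2) ∈ φ.domain ∧ (q.1, φ.toFun q.2.1 q.2.2) ∈ φ.domain ∧
      ∀ᶠ y in 𝓝 q.2.2, φ.toFun (q.2.1 + q.1) y = φ.toFun q.1 (φ.toFun q.2.1 y) := by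
  have h1 : ContinuousAt (fun q : ℂ × (ℂ × M) => (q.2.1, q.2.2)) ((0 : ℂ), (t, x)) := by fun_prop
  have h2 : ContinuousAt (fun q : ℂ × (ℂ × M) => φ.toFun q.2.1 q.2.2) ((0 : ℂ), (t, x)) :=
    ContinuousAt.comp (f := fun q : ℂ × (ℂ × M) => (q.2.1, q.2.2)) (φ.continuousAt h) h1
  have h3 : ContinuousAt (fun q : ℂ × (ℂ × M) => (q.1, φ.toFun q.2.1 q.2.2)) ((0 : ℂ), (t, x)) :=
    continuousAt_fst.prodMk h2
  filter_upwards [h1.eventually (φ.isOpen_domain.mem_nhds h),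
    h3.eventually (φ.isOpen_domain.mem_nhds (φ.zero_mem _)),
    eventually_eventually_nhds.2 (φ.map_add t x h)] with q hq1 hq2 hq3
  refine ⟨hq1, hq2, ?_⟩
  have h4 : Tendsto (fun y : M => (q.1, (q.2.1, y))) (𝓝 q.2.2) (𝓝 q) :=
    (Continuous.prodMk_right q.1).comp (Continuous.prodMk_right q.2.1) |>.tendsto q.2.2
  exact h4.eventually hq3

/-- Near `x` and its image, `φ_a` and `φ_b` are inverse to each other. -/
structure LocalFlow.IsInvAt (φ : LocalFlow X) (a b : ℂ) (x : M) : Prop where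
  mem : (a, x) ∈ φ.domain
  mem_image : (b, φ.toFun a x) ∈ φ.domain
  left : ∀ᶠ y in 𝓝 x, φ.toFun b (φ.toFun a y) = y
  right : ∀ᶠ y in 𝓝 (φ.toFun a x), φ.toFun a (φ.toFun b y) = y

theorem LocalFlow.IsInvAt.symm {φ : LocalFlow X} {a b : ℂ} {x : M} (h : φ.IsInvAt a b x) :
    φ.IsInvAt b a (φ.toFun a x) where
  mem := h.mem_image
  mem_image := by
    rw [h.left.self_of_nhds]
    exact h.mem
  left := h.right
  right := by
    rw [h.left.self_of_nhds]
    exact h.left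

theorem LocalFlow.eventually_isInvAt (φ : LocalFlow X) (x : M) :
    ∀ᶠ q : ℂ × M in 𝓝 ((0 : ℂ), x), φ.IsInvAt q.1 (-q.1) q.2 := by
  have hadd := φ.eventually_add (φ.zero_mem x)
  have h1 : Tendsto (fun q : ℂ × M => (-q.1, (q.1, q.2))) (𝓝 ((0 : ℂ), x))
      (𝓝 ((0 : ℂ), ((0 : ℂ), x))) := by
    have : Continuous (fun q : ℂ × M => (-q.1, (q.1, q.2))) := by fun_prop
    simpa using this.tendsto ((0 : ℂ), x)
  have h2 : Tendsto (fun q : ℂ × M => (q.1, (-q.1, φ.toFun q.1 q.2))) (𝓝 ((0 : ℂ), x))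
      (𝓝 ((0 : ℂ), ((0 : ℂ), x))) := by
    have hc := φ.continuousAt (φ.zero_mem x)
    have : ContinuousAt (fun q : ℂ × M => (q.1, (-q.1, φ.toFun q.1 q.2))) ((0 : ℂ), x) := by
      fun_prop
    simpa [ContinuousAt, φ.map_zero] using this
  filter_upwards [h1.eventually hadd, h2.eventually hadd] with q hq1 hq2
  refine ⟨hq1.1, hq1.2.1, ?_, ?_⟩
  · filter_upwards [hq1.2.2] with y hy
    simpa [φ.map_zero] using hy.symm
  · filter_upwards [hq2.2.2] with y hy
    simpa [φ.map_zero] using hy.symm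

end Germs

variable {S : Type*} [TopologicalSpace S] [ChartedSpace C2 S] [IsManifold 𝓘(ℂ, C2) ω S]
  {ρ : HolRep} {C : ConformalCartan S ρ} {X : Π x : S, TangentSpace 𝓘(ℂ, C2) x}
  {φ : LocalFlow X}

theorem continuous_totV_proj : Continuous (fun u : TotV S ρ => u.1) :=
  (contMDiff_proj (IB := 𝓘(ℂ, C2)) (n := ω) (fun x : S => V ρ x)).continuous

theorem totV_snd_eq {x y : S} {v w : C4} (h : (⟨x, v⟩ : TotV S ρ) = ⟨y, w⟩) : v = w :=
  congrArg (fun u : TotV S ρ => (u.2 : C4)) h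

/-- The induced maps on the total space satisfy the flow property. -/
theorem ConformalCartan.IsPreservedBy.eventually_pushTot_add (hφ : C.IsPreservedBy φ) {t : ℂ}
    {u : TotV S ρ} (h : (t, u.1) ∈ φ.domain) :
    ∀ᶠ q : ℂ × (ℂ × TotV S ρ) in 𝓝 ((0 : ℂ), (t, u)),
      (q.2.1, q.2.2.1) ∈ φ.domain ∧ (q.1, φ.toFun q.2.1 q.2.2.1) ∈ φ.domain ∧
      pushTot φ q.1 (pushTot φ q.2.1 q.2.2) = pushTot φ (q.2.1 + q.1) q.2.2 := by
  have hp := continuous_totV_proj (S := S) (ρ := ρ)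
  have hc : Continuous (fun q : ℂ × (ℂ × TotV S ρ) => (q.1, (q.2.1, q.2.2.1))) := by fun_prop
  filter_upwards [(hc.tendsto ((0 : ℂ), (t, u))).eventually (φ.eventually_add h)] with q hq
  exact ⟨hq.1, hq.2.1, pushTot_pushTot φ hq.1 hq.2.1 hq.2.2 (hφ.isUnit_jac hq.1)
    (hφ.isUnit_jac hq.2.1)⟩

/-- The section `(φ_a)_* e` of `V`, if `φ_b` is the local inverse of `φ_a`. -/
noncomputable def transport (φ : LocalFlow X) (a b : ℂ) (e : Π y : S, V ρ y) : Π y : S, V ρ y :=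
  fun y => (push ρ φ a (φ.toFun b y) (e (φ.toFun b y)) : C4)

variable {a b : ℂ} {x : S}

theorem eventually_transport (hinv : φ.IsInvAt a b x) (e : Π y : S, V ρ y) :
    ∀ᶠ y in 𝓝 x, transport φ a b e (φ.toFun a y) = push ρ φ a y (e y) := by
  filter_upwards [hinv.left] with y hy
  have : ∀ z : S, z = y → (push ρ φ a z (e z) : C4) = push ρ φ a y (e y) := by
    rintro z rfl
    rfl
  exact this _ hy

/-- Near the image point, the transported section is the composite of `φ_b`, the section `e` and the
induced map of `φ_a`. -/
theorem holAt_transport (hφ : C.IsPreservedBy φ) (hinv : φ.IsInvAt a b x) {e : Π y : S, V ρ y}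
    (he : HolAt e x) : HolAt (transport φ a b e) (φ.toFun a x) := by
  have hx : φ.toFun b (φ.toFun a x) = x := hinv.left.self_of_nhds
  have h1 : ContMDiffAt 𝓘(ℂ, C2) 𝓘(ℂ, C2) ω (φ.toFun b) (φ.toFun a x) :=
    ContMDiffAt.comp (I' := 𝓘(ℂ, ℂ).prod 𝓘(ℂ, C2)) (φ.toFun a x) (g := fun p : ℂ × S => φ.toFun p.1 p.2)
      (f := fun y : S => (b, y)) (φ.contMDiffAt hinv.mem_image)
      (contMDiffAt_const.prodMk contMDiffAt_id)
  have h2 : ContMDiffAt 𝓘(ℂ, C2) (𝓘(ℂ, C2).prod 𝓘(ℂ, C4)) ω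
      (fun y : S => (⟨φ.toFun b y, e (φ.toFun b y)⟩ : TotV S ρ)) (φ.toFun a x) := by
    refine ContMDiffAt.comp (φ.toFun a x) (g := fun y : S => (⟨y, e y⟩ : TotV S ρ))
      (f := φ.toFun b) ?_ h1
    rw [hx]
    exact he
  have h3 : ContMDiffAt 𝓘(ℂ, C2) (𝓘(ℂ, C2).prod 𝓘(ℂ, C4)) ω
      (fun y : S => pushTot φ a (⟨φ.toFun b y, e (φ.toFun b y)⟩ : TotV S ρ)) (φ.toFun a x) := by
    refine ContMDiffAt.comp (φ.toFun a x) (g := fun q : ℂ × TotV S ρ => pushTot φ q.1 q.2)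
      (f := fun y : S => (a, (⟨φ.toFun b y, e (φ.toFun b y)⟩ : TotV S ρ))) ?_
      ((contMDiffAt_const (I' := 𝓘(ℂ, ℂ))).prodMk h2)
    exact hφ.contMDiffAt_pushTot (by simpa [hx] using hinv.mem)
  refine h3.congr_of_eventuallyEq ?_
  filter_upwards [hinv.right] with y hy
  exact totV_mk_eq hy.symm rfl

/-- Allows preservation of `𝒟` to be used with a section prescribed near the image point, by pulling
it back. -/
theorem eventually_push_transport (hφ : C.IsPreservedBy φ) (hinv : φ.IsInvAt a b x)
    (f : Π y : S, V ρ y) :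
    ∀ᶠ y in 𝓝 x, f (φ.toFun a y) = push ρ φ a y (transport φ b a f y) := by
  have hcont := φ.continuousAt_toFun hinv.mem
  have h1 : ∀ᶠ y in 𝓝 x, (a, y) ∈ φ.domain :=
    (Continuous.prodMk_right a).continuousAt.eventually (φ.isOpen_domain.mem_nhds hinv.mem)
  have h2 : ∀ᶠ y in 𝓝 x, (b, φ.toFun a y) ∈ φ.domain :=
    hcont.eventually ((Continuous.prodMk_right b).continuousAt.eventually
      (φ.isOpen_domain.mem_nhds hinv.mem_image))
  filter_upwards [hinv.left, h1, h2, hcont.eventually (eventually_eventually_nhds.2 hinv.right)]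
    with y hy h1 h2 h3
  have h4 : (a, φ.toFun b (φ.toFun a y)) ∈ φ.domain := by rwa [hy]
  have h5 := pushTot_pushTot (ρ := ρ) φ (a := 0) (b := a) (c := b)
    (u := ⟨φ.toFun a y, f (φ.toFun a y)⟩) h2 h4
    (h3.mono fun z hz => by rw [φ.map_zero, hz]) (hφ.isUnit_jac h2) (hφ.isUnit_jac h4)
  rw [pushTot_zero] at h5
  have h6 := totV_snd_eq h5
  have : ∀ z : S, z = y → ∀ v : C4, (push ρ φ a z v : C4) = push ρ φ a y v := by
    rintro z rfl v
    rfl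
  exact h6.symm.trans (this _ hy _)

/-! ### Lifted curves under the flow. -/

namespace NullSubbundles

variable (N : NullSubbundles C) {s : Side}

/-- The flow preserves the line bundles `t^±`. -/
theorem jac_mem_tangentLine (hφ : C.IsPreservedBy φ) (hinv : φ.IsInvAt a b x)
    {w : TangentSpace 𝓘(ℂ, C2) x} (hw : w ∈ N.tangentLine s x) :
    (φ.jac a x w : C2) ∈ N.tangentLine s (φ.toFun a x) := by
  intro f hf hL
  have hx : φ.toFun b (φ.toFun a x) = x := hinv.left.self_of_nhds
  have he : HolAt (transport φ b a f) x := by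
    have := holAt_transport hφ hinv.symm hf
    rwa [hx] at this
  have hmem : ∀ᶠ y in 𝓝 x, (b, φ.toFun a y) ∈ φ.domain :=
    (φ.continuousAt_toFun hinv.mem).eventually ((Continuous.prodMk_right b).continuousAt.eventually
      (φ.isOpen_domain.mem_nhds hinv.mem_image))
  have heL : ∀ᶠ y in 𝓝 x, transport φ b a f y ∈ C.L y := by
    filter_upwards [hinv.left, hmem, (φ.continuousAt_toFun hinv.mem).eventually hL]
      with y hy h1 h2
    have h3 := hφ.line b _ h1 _ h2
    have : ∀ z : S, z = y → ∀ v : C4, v ∈ C.L z → v ∈ C.L y := by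
      rintro z rfl v hv
      exact hv
    exact this _ hy _ h3
  have hc := hφ.connection a x hinv.mem _ f he hf (eventually_push_transport hφ hinv f) w
  have : C.D.toFun f (φ.toFun a x) (φ.jac a x w : C2) =
      push ρ φ a x (C.D.toFun (transport φ b a f) x w) := hc
  rw [this]
  exact N.push_mem_U hφ s hinv.mem (hw _ he heL)

/-- The curve `G` in `V` is at `z` a `𝒟`-horizontal lift of an immersed integral curve of `t^±`. -/
def IsLiftedAt (s : Side) (G : ℂ → TotV S ρ) (z : ℂ) : Prop :=
  ContMDiffAt 𝓘(ℂ, ℂ) (𝓘(ℂ, C2).prod 𝓘(ℂ, C4)) ω G z ∧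
  ∃ (x : S) (v : V ρ x) (w : TangentSpace 𝓘(ℂ, C2) x), G z = ⟨x, v⟩ ∧
    (mfderiv 𝓘(ℂ, ℂ) 𝓘(ℂ, C2) (fun z => (G z).1) z (1 : ℂ) : C2) = w ∧
    w ≠ 0 ∧ w ∈ N.tangentLine s x ∧
    ∃ e : Π y : S, V ρ y, HolAt e x ∧ e x = v ∧ C.D.toFun e x w = 0 ∧
      (mfderiv 𝓘(ℂ, ℂ) (𝓘(ℂ, C2).prod 𝓘(ℂ, C4))
        (fun z => (⟨(G z).1, e (G z).1⟩ : TotV S ρ)) z (1 : ℂ) : C2 × C4) =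
      mfderiv 𝓘(ℂ, ℂ) (𝓘(ℂ, C2).prod 𝓘(ℂ, C4)) G z (1 : ℂ)

variable {N}

theorem IsLiftedAt.congr {G G' : ℂ → TotV S ρ} {z : ℂ} (h : N.IsLiftedAt s G z)
    (hG : G' =ᶠ[𝓝 z] G) : N.IsLiftedAt s G' z := by
  obtain ⟨hs, x, v, w, hx, hw, hw0, hwt, e, he, hev, hD, hder⟩ := h
  refine ⟨hs.congr_of_eventuallyEq hG, x, v, w, hG.self_of_nhds.trans hx, ?_, hw0, hwt, e, he,
    hev, hD, ?_⟩
  · have h1 : (fun z => (G' z).1) =ᶠ[𝓝 z] fun z => (G z).1 := hG.fun_comp TotalSpace.proj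
    have h2 := h1.mfderiv_eq (I := 𝓘(ℂ, ℂ)) (I' := 𝓘(ℂ, C2))
    exact (congrArg (fun A : ℂ →L[ℂ] C2 => A (1 : ℂ)) h2).trans hw
  · have h1 : (fun z => (⟨(G' z).1, e (G' z).1⟩ : TotV S ρ)) =ᶠ[𝓝 z]
        fun z => (⟨(G z).1, e (G z).1⟩ : TotV S ρ) :=
      hG.fun_comp fun u : TotV S ρ => (⟨u.1, e u.1⟩ : TotV S ρ)
    have h2 := h1.mfderiv_eq (I := 𝓘(ℂ, ℂ)) (I' := 𝓘(ℂ, C2).prod 𝓘(ℂ, C4))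
    have h3 := hG.mfderiv_eq (I := 𝓘(ℂ, ℂ)) (I' := 𝓘(ℂ, C2).prod 𝓘(ℂ, C4))
    exact ((congrArg (fun A : ℂ →L[ℂ] (C2 × C4) => A (1 : ℂ)) h2).trans hder).trans
      (congrArg (fun A : ℂ →L[ℂ] (C2 × C4) => A (1 : ℂ)) h3).symm

/-- The pointwise form names the base point, the vector and the velocity separately, so curves can
be changed without casts between fibres. -/
theorem isLiftedCurve_iff {g : ℂ → N.NonzeroU s} : N.IsLiftedCurve s g ↔
    ∀ z ∈ Metric.ball (0 : ℂ) 1, N.IsLiftedAt s (fun z => (g z).1) z := by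
  constructor
  · intro h z hz
    obtain ⟨e, he, hev, hD, hder⟩ := h.horizontal z hz
    exact ⟨(h.holomorphic z hz).contMDiffAt (Metric.isOpen_ball.mem_nhds hz), _, _, _, rfl, rfl,
      (h.integral z hz).1, (h.integral z hz).2, e, he, hev, hD, hder⟩
  · intro h
    refine ⟨fun z hz => (h z hz).1.contMDiffWithinAt, fun z hz => ?_, fun z hz => ?_⟩
    · obtain ⟨-, x, v, w, hx, hw, hw0, hwt, -⟩ := h z hz
      have : ∀ u : TotV S ρ, u = ⟨x, v⟩ → ∀ d : C2, d = w → d ≠ 0 ∧ d ∈ N.tangentLine s u.1 := by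
        rintro _ rfl _ rfl
        exact ⟨hw0, hwt⟩
      exact this _ hx _ hw
    · obtain ⟨-, x, v, w, hx, hw, -, -, e, he, hev, hD, hder⟩ := h z hz
      have : ∀ u : TotV S ρ, u = ⟨x, v⟩ → ∀ d : C2, d = w →
          HolAt e u.1 ∧ e u.1 = u.2 ∧ C.D.toFun e u.1 d = 0 := by
        rintro _ rfl _ rfl
        exact ⟨he, hev, hD⟩
      obtain ⟨h1, h2, h3⟩ := this _ hx _ hw
      exact ⟨e, h1, h2, h3, hder⟩

/-- The flow preserves the `𝒟`-horizontal lifts of integral curves of `t^±`. -/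
theorem IsLiftedAt.push (hφ : C.IsPreservedBy φ) {G : ℂ → TotV S ρ} {z : ℂ}
    (h : N.IsLiftedAt s G z) (hinv : φ.IsInvAt a b (G z).1) :
    N.IsLiftedAt s (fun z => pushTot φ a (G z)) z := by
  obtain ⟨hs, x, v, w, hx, hw, hw0, hwt, e, he, hev, hD, hder⟩ := h
  have hx1 : (G z).1 = x := by rw [hx]
  rw [hx1] at hinv
  have hpush : ∀ u : TotV S ρ, u.1 = x → ContMDiffAt (𝓘(ℂ, C2).prod 𝓘(ℂ, C4))
      (𝓘(ℂ, C2).prod 𝓘(ℂ, C4)) ω (fun u : TotV S ρ => pushTot φ a u) u := fun u hu =>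
    ContMDiffAt.comp u (g := fun q : ℂ × TotV S ρ => pushTot φ q.1 q.2) (f := fun u => (a, u))
      (hφ.contMDiffAt_pushTot (by rw [hu]; exact hinv.mem))
      (contMDiffAt_const.prodMk contMDiffAt_id)
  have hγ : ContMDiffAt 𝓘(ℂ, ℂ) 𝓘(ℂ, C2) ω (fun z => (G z).1) z := (contMDiffAt_totalSpace.1 hs).1
  refine ⟨ContMDiffAt.comp z (g := fun u : TotV S ρ => pushTot φ a u) (hpush _ hx1) hs,
    φ.toFun a x, CartanGluing.push ρ φ a x v, (φ.jac a x w : C2), ?_, ?_, ?_,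
    N.jac_mem_tangentLine hφ hinv hwt, transport φ a b e, holAt_transport hφ hinv he, ?_, ?_, ?_⟩
  · show pushTot φ a (G z) = pushTot φ a ⟨x, v⟩
    rw [hx]
  · have hc := mfderiv_comp z (g := φ.toFun a) (f := fun z => (G z).1)
      (φ.mdifferentiableAt (by rw [hx1]; exact hinv.mem)) (hγ.mdifferentiableAt (by simp))
    have h1 : (mfderiv 𝓘(ℂ, ℂ) 𝓘(ℂ, C2) (fun z => (pushTot φ a (G z)).1) z (1 : ℂ) : C2) =
        φ.jac a (G z).1 (mfderiv 𝓘(ℂ, ℂ) 𝓘(ℂ, C2) (fun z => (G z).1) z (1 : ℂ) : C2) :=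
      congrArg (fun A : ℂ →L[ℂ] C2 => A (1 : ℂ)) hc
    rw [h1, hw, hx1]
  · intro h0
    obtain ⟨u, hu⟩ := hφ.isUnit_jac hinv.mem
    have h1 : (((u⁻¹ : (C2 →L[ℂ] C2)ˣ) : C2 →L[ℂ] C2) * (u : C2 →L[ℂ] C2)) (w : C2) = w := by
      rw [Units.inv_mul]
      rfl
    rw [hu] at h1
    refine hw0 (h1.symm.trans ?_)
    exact (congrArg ((u⁻¹ : (C2 →L[ℂ] C2)ˣ) : C2 →L[ℂ] C2) h0).trans (map_zero _)
  · rw [(eventually_transport hinv e).self_of_nhds, hev]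
  · have hc := hφ.connection a x hinv.mem e _ he (holAt_transport hφ hinv he)
      (eventually_transport hinv e) w
    refine Eq.trans hc ?_
    rw [hD]
    exact map_zero (pushₗ ρ φ a x)
  · have he' : ContMDiffAt 𝓘(ℂ, ℂ) (𝓘(ℂ, C2).prod 𝓘(ℂ, C4)) ω
        (fun z => (⟨(G z).1, e (G z).1⟩ : TotV S ρ)) z :=
      ContMDiffAt.comp z (g := fun y : S => (⟨y, e y⟩ : TotV S ρ)) (f := fun z => (G z).1)
        (by rw [hx1]; exact he) hγ
    -- Along the image curve the transported section is the image of `e` along the original curve.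
    -- Both sides of the tangency condition thus come from the old ones by the differential of the
    -- same induced map.
    have heq : (fun z => (⟨(pushTot φ a (G z)).1, transport φ a b e (pushTot φ a (G z)).1⟩ :
        TotV S ρ)) =ᶠ[𝓝 z] (fun u => pushTot φ a u) ∘
          (fun z => (⟨(G z).1, e (G z).1⟩ : TotV S ρ)) := by
      have hev2 : ∀ᶠ y in 𝓝 (G z).1,
          transport φ a b e (φ.toFun a y) = CartanGluing.push ρ φ a y (e y) := by
        rw [hx1]
        exact eventually_transport hinv e
      filter_upwards [hγ.continuousAt.eventually hev2] with z' hz'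
      exact totV_mk_eq rfl hz'
    have h1 := heq.mfderiv_eq (I := 𝓘(ℂ, ℂ)) (I' := 𝓘(ℂ, C2).prod 𝓘(ℂ, C4))
    have hpt : (⟨(G z).1, e (G z).1⟩ : TotV S ρ) = G z := by
      rw [hx]
      exact totV_mk_eq rfl hev
    have h2 := mfderiv_comp z (I := 𝓘(ℂ, ℂ)) (g := fun u => pushTot φ a u)
      (f := fun z => (⟨(G z).1, e (G z).1⟩ : TotV S ρ))
      ((hpush ⟨(G z).1, e (G z).1⟩ hx1).mdifferentiableAt (by simp)) (he'.mdifferentiableAt (by simp))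
    have h3 := mfderiv_comp z (I := 𝓘(ℂ, ℂ)) (g := fun u => pushTot φ a u) (f := G)
      ((hpush _ hx1).mdifferentiableAt (by simp)) (hs.mdifferentiableAt (by simp))
    let P : TotV S ρ → (C2 × C4) →L[ℂ] (C2 × C4) := fun u =>
      mfderiv (𝓘(ℂ, C2).prod 𝓘(ℂ, C4)) (𝓘(ℂ, C2).prod 𝓘(ℂ, C4)) (fun u => pushTot φ a u) u
    have h4 := (congrArg (fun A : ℂ →L[ℂ] (C2 × C4) => A (1 : ℂ)) (h1.trans h2))
    have h5 := (congrArg (fun A : ℂ →L[ℂ] (C2 × C4) => A (1 : ℂ)) h3)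
    refine h4.trans (Eq.trans ?_ h5.symm)
    exact (congrArg (P _) hder).trans (congrArg (fun u => P u _) hpt)

/-- All velocities are multiplied by the nonzero factor `ε`, and the conditions are linear in them.
Used to rescale small discs to the unit disc. -/
theorem IsLiftedAt.comp_affine {G : ℂ → TotV S ρ} {z₀ ε ζ : ℂ} (hε : ε ≠ 0)
    (h : N.IsLiftedAt s G (z₀ + ε * ζ)) : N.IsLiftedAt s (fun ζ => G (z₀ + ε * ζ)) ζ := by
  obtain ⟨hs, x, v, w, hx, hw, hw0, hwt, e, he, hev, hD, hder⟩ := h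
  let m : ℂ → ℂ := fun ζ => z₀ + ε * ζ
  have hm : HasDerivAt m ε ζ := by
    have := ((hasDerivAt_id ζ).const_mul ε).const_add z₀
    rwa [mul_one] at this
  have hm' : HasMFDerivAt 𝓘(ℂ, ℂ) 𝓘(ℂ, ℂ) m ζ ((1 : ℂ →L[ℂ] ℂ).smulRight ε) :=
    hm.hasFDerivAt.hasMFDerivAt
  have hms : ContMDiffAt 𝓘(ℂ, ℂ) 𝓘(ℂ, ℂ) ω m ζ := by
    have : ContDiff ℂ ω m := by fun_prop
    exact this.contMDiff ζ
  have hγ : ContMDiffAt 𝓘(ℂ, ℂ) 𝓘(ℂ, C2) ω (fun z => (G z).1) (m ζ) :=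
    (contMDiffAt_totalSpace.1 hs).1
  have hx1 : (G (m ζ)).1 = x := by
    have : G (m ζ) = ⟨x, v⟩ := hx
    rw [this]
  have he' : ContMDiffAt 𝓘(ℂ, ℂ) (𝓘(ℂ, C2).prod 𝓘(ℂ, C4)) ω
      (fun z => (⟨(G z).1, e (G z).1⟩ : TotV S ρ)) (m ζ) :=
    ContMDiffAt.comp (m ζ) (g := fun y : S => (⟨y, e y⟩ : TotV S ρ)) (f := fun z => (G z).1)
      (by rw [hx1]; exact he) hγ
  have hsc : ∀ (F : Type) [AddCommGroup F] [Module ℂ F] [TopologicalSpace F]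
      (A : ℂ →L[ℂ] F), A (((1 : ℂ →L[ℂ] ℂ).smulRight ε) (1 : ℂ)) = ε • A 1 := by
    intro F _ _ _ A
    rw [← map_smul]
    simp
  have h1 := congrArg (fun A : ℂ →L[ℂ] C2 => A (1 : ℂ))
    (HasMFDerivAt.comp ζ (hγ.mdifferentiableAt (by simp)).hasMFDerivAt hm').mfderiv
  have h2 := congrArg (fun A : ℂ →L[ℂ] (C2 × C4) => A (1 : ℂ))
    (HasMFDerivAt.comp ζ (he'.mdifferentiableAt (by simp)).hasMFDerivAt hm').mfderiv
  have h3 := congrArg (fun A : ℂ →L[ℂ] (C2 × C4) => A (1 : ℂ))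
    (HasMFDerivAt.comp ζ (hs.mdifferentiableAt (by simp)).hasMFDerivAt hm').mfderiv
  refine ⟨ContMDiffAt.comp ζ (g := G) (f := m) hs hms, x, v, ε • w, hx, ?_,
    smul_ne_zero hε hw0, (N.tangentLine s x).smul_mem ε hwt, e, he, hev, ?_, ?_⟩
  · refine (h1.trans (hsc C2 _)).trans ?_
    exact congrArg (fun u : C2 => ε • u) hw
  · rw [map_smul, hD, smul_zero]
  · refine (h2.trans (hsc (C2 × C4) _)).trans (Eq.trans ?_ (h3.trans (hsc (C2 × C4) _)).symm)
    exact congrArg (fun u : C2 × C4 => ε • u) hder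

end NullSubbundles

end CartanGluing

/-! ### The flows on the leaf spaces. -/

namespace CartanGluing

namespace NullSubbundles

variable {S : Type*} [TopologicalSpace S] [ChartedSpace C2 S] [IsManifold 𝓘(ℂ, C2) ω S]
  {ρ : HolRep} {C : ConformalCartan S ρ} {X : Π x : S, TangentSpace 𝓘(ℂ, C2) x}
  {φ : LocalFlow X} (N : NullSubbundles C) (hφ : C.IsPreservedBy φ) (s : Side)

include hφ in
theorem pushTot_mem {t : ℂ} {u : TotV S ρ} (h : (t, u.1) ∈ φ.domain)
    (hu : u.2 ∈ N.U s u.1 ∧ u.2 ≠ 0) :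
    (pushTot φ t u).2 ∈ N.U s (pushTot φ t u).1 ∧ (pushTot φ t u).2 ≠ 0 :=
  ⟨N.push_mem_U hφ s h hu.1, hφ.push_ne_zero h hu.2⟩

open Classical in
/-- The map induced by the flow on the nonzero vectors of `U^±`; outside the domain of the flow it
has the junk value `v`. -/
noncomputable def flowU (t : ℂ) (v : N.NonzeroU s) : N.NonzeroU s :=
  if h : (t, v.1.1) ∈ φ.domain then ⟨pushTot φ t v.1, N.pushTot_mem hφ s h v.2⟩ else v

theorem flowU_eq {t : ℂ} {v : N.NonzeroU s} (h : (t, v.1.1) ∈ φ.domain) :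
    N.flowU hφ s t v = ⟨pushTot φ t v.1, N.pushTot_mem hφ s h v.2⟩ := dif_pos h

theorem flowU_val {t : ℂ} {v : N.NonzeroU s} (h : (t, v.1.1) ∈ φ.domain) :
    (N.flowU hφ s t v).1 = pushTot φ t v.1 := by rw [flowU_eq N hφ s h]

theorem flowU_zero (v : N.NonzeroU s) : N.flowU hφ s 0 v = v :=
  Subtype.ext ((N.flowU_val hφ s (φ.zero_mem _)).trans (pushTot_zero φ v.1))

theorem toF_surjective : Function.Surjective (N.toF s) := by
  rintro ⟨⟨x, p⟩, hp⟩
  refine ⟨⟨⟨x, p.rep⟩, ?_, p.rep_nonzero⟩, ?_⟩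
  · rw [← Submodule.span_singleton_le_iff_mem, ← Projectivization.submodule_eq]
    exact hp
  · refine Subtype.ext ?_
    exact congrArg (Sigma.mk x) p.mk_rep

/-- The induced maps are linear on fibres, so proportional vectors have proportional images; outside
the domain the junk value changes nothing. -/
theorem toF_flowU_eq {t : ℂ} {v v' : N.NonzeroU s} (h : N.toF s v = N.toF s v') :
    N.toF s (N.flowU hφ s t v) = N.toF s (N.flowU hφ s t v') := by
  obtain ⟨⟨x, w⟩, hw, hw0⟩ := v
  obtain ⟨⟨y, w'⟩, hw', hw0'⟩ := v'
  have h1 := congrArg Subtype.val h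
  have hxy : x = y := congrArg Sigma.fst h1
  subst hxy
  by_cases hm : (t, x) ∈ φ.domain
  · have h2 := eq_of_heq (Sigma.mk.inj h1).2
    obtain ⟨c, hc⟩ := (Projectivization.mk_eq_mk_iff' ℂ _ _ hw0 hw0').1 h2
    refine (congrArg (N.toF s) (flowU_eq N hφ s (v := ⟨⟨x, w⟩, hw, hw0⟩) hm)).trans
      (Eq.trans ?_ (congrArg (N.toF s) (flowU_eq N hφ s (v := ⟨⟨x, w'⟩, hw', hw0'⟩) hm)).symm)
    refine Subtype.ext (congrArg (Sigma.mk (φ.toFun t x)) ?_)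
    refine (Projectivization.mk_eq_mk_iff' ℂ _ _ _ _).2 ⟨c, ?_⟩
    refine (push_smul φ t x c w').symm.trans ?_
    rw [show c • w' = w from hc]
    rfl
  · have hid : ∀ u : N.NonzeroU s, (t, u.1.1) ∉ φ.domain → N.flowU hφ s t u = u :=
      fun u hu => dif_neg hu
    exact (congrArg (N.toF s) (hid ⟨⟨x, w⟩, hw, hw0⟩ hm)).trans
      (h.trans (congrArg (N.toF s) (hid ⟨⟨x, w'⟩, hw', hw0'⟩ hm)).symm)

variable {N s}

/-- Along a lifted curve, the leaf of the image under the flow is locally constant, uniformly for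
small times. -/
theorem IsLiftedCurve.eventually_leaf_flowU_eq {g : ℂ → N.NonzeroU s} (hg : N.IsLiftedCurve s g)
    {z₀ : ℂ} (hz₀ : z₀ ∈ Metric.ball (0 : ℂ) 1) :
    ∀ᶠ z in 𝓝 z₀, ∀ᶠ t in 𝓝 (0 : ℂ),
      N.leaf s (N.toF s (N.flowU hφ s t (g z₀))) = N.leaf s (N.toF s (N.flowU hφ s t (g z))) := by
  have hlift := isLiftedCurve_iff.1 hg
  have hγ : ContinuousAt (fun z => (g z).1.1) z₀ :=
    (contMDiffAt_totalSpace.1 (hlift z₀ hz₀).1).1.continuousAt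
  have hc : ContinuousAt (fun q : ℂ × ℂ => (q.1, (g q.2).1.1)) ((0 : ℂ), z₀) :=
    continuousAt_fst.prodMk (ContinuousAt.comp (g := fun z => (g z).1.1) (f := fun q : ℂ × ℂ => q.2)
      hγ continuousAt_snd)
  have hev : ∀ᶠ q : ℂ × ℂ in 𝓝 ((0 : ℂ), z₀),
      φ.IsInvAt q.1 (-q.1) (g q.2).1.1 ∧ q.2 ∈ Metric.ball (0 : ℂ) 1 :=
    -- Joint openness in time and curve parameter gives one radius `ε` that serves for both.
    (hc.eventually (φ.eventually_isInvAt _)).and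
      (continuousAt_snd.eventually (Metric.isOpen_ball.mem_nhds hz₀))
  obtain ⟨ε, hε, hball⟩ := Metric.eventually_nhds_iff_ball.1 hev
  have hgood : ∀ t ∈ Metric.ball (0 : ℂ) ε, ∀ z ∈ Metric.ball z₀ ε,
      φ.IsInvAt t (-t) (g z).1.1 ∧ z ∈ Metric.ball (0 : ℂ) 1 := fun t ht z hz =>
    hball (t, z) (by rw [← ball_prod_same]; exact ⟨ht, hz⟩)
  have hε0 : (ε : ℂ) ≠ 0 := by exact_mod_cast hε.ne'
  have hmem : ∀ ζ ∈ Metric.ball (0 : ℂ) 1, z₀ + ε * ζ ∈ Metric.ball z₀ ε := by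
    intro ζ hζ
    rw [mem_ball_zero_iff] at hζ
    rw [mem_ball_iff_norm, add_sub_cancel_left, norm_mul, Complex.norm_real,
      Real.norm_of_nonneg hε.le]
    nlinarith
  filter_upwards [Metric.ball_mem_nhds z₀ hε] with z hz
  filter_upwards [Metric.ball_mem_nhds (0 : ℂ) hε] with t ht
  -- The image of the `ε`-disc about `z₀`, rescaled to the unit disc, is one lifted curve through
  -- both points.
  refine Quot.sound ⟨fun ζ => N.flowU hφ s t (g (z₀ + ε * ζ)), ?_, 0, by simp,
    (z - z₀) / ε, ?_, by simp, ?_⟩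
  · rw [isLiftedCurve_iff]
    intro ζ hζ
    obtain ⟨h1, h2⟩ := hgood t ht _ (hmem ζ hζ)
    have h3 : N.IsLiftedAt s (fun z => pushTot φ t (g z).1) (z₀ + ε * ζ) :=
      (hlift _ h2).push hφ h1
    refine (h3.comp_affine hε0).congr ?_
    filter_upwards [Metric.isOpen_ball.mem_nhds hζ] with ζ' hζ'
    exact N.flowU_val hφ s (hgood t ht _ (hmem ζ' hζ')).1.mem
  · rw [mem_ball_iff_norm] at hz
    rw [mem_ball_zero_iff, norm_div, Complex.norm_real, Real.norm_of_nonneg hε.le, div_lt_one hε]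
    exact hz
  · beta_reduce
    rw [mul_div_cancel₀ _ hε0, add_sub_cancel]

/-- The local statement spreads over the connected parameter disc. -/
theorem LeafRel.eventually_leaf_flowU_eq {v v' : N.NonzeroU s}
    (h : N.LeafRel s (N.toF s v) (N.toF s v')) :
    ∀ᶠ t in 𝓝 (0 : ℂ),
      N.leaf s (N.toF s (N.flowU hφ s t v)) = N.leaf s (N.toF s (N.flowU hφ s t v')) := by
  obtain ⟨g, hg, z, hz, w, hw, hzv, hwv⟩ := h
  have hpre : IsPreconnected (Metric.ball (0 : ℂ) 1) := (convex_ball 0 1).isPreconnected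
  have key := hpre.induction₂ (fun z w => ∀ᶠ t in 𝓝 (0 : ℂ),
      N.leaf s (N.toF s (N.flowU hφ s t (g z))) = N.leaf s (N.toF s (N.flowU hφ s t (g w))))
    (fun z hz => nhdsWithin_le_nhds (hg.eventually_leaf_flowU_eq hφ hz))
    (fun a b c _ _ _ h1 h2 => by filter_upwards [h1, h2] with t h1 h2 using h1.trans h2)
    (fun a b _ _ h1 => by filter_upwards [h1] with t h1 using h1.symm) hz hw
  filter_upwards [key] with t ht
  rw [← N.toF_flowU_eq hφ s hzv, ← N.toF_flowU_eq hφ s hwv, ht]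

/-- Points of one leaf are joined by a finite chain of curve pieces, so finitely many neighbourhoods
of time `0` are intersected. -/
theorem eventually_leaf_flowU_eq {v v' : N.NonzeroU s}
    (h : N.leaf s (N.toF s v) = N.leaf s (N.toF s v')) :
    ∀ᶠ t in 𝓝 (0 : ℂ),
      N.leaf s (N.toF s (N.flowU hφ s t v)) = N.leaf s (N.toF s (N.flowU hφ s t v')) := by
  have key : ∀ p q : N.F s, Relation.EqvGen (N.LeafRel s) p q → ∀ v v' : N.NonzeroU s,
      N.toF s v = p → N.toF s v' = q → ∀ᶠ t in 𝓝 (0 : ℂ),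
        N.leaf s (N.toF s (N.flowU hφ s t v)) = N.leaf s (N.toF s (N.flowU hφ s t v')) := by
    intro p q hpq
    induction hpq with
    | rel p q hr =>
      rintro v v' rfl rfl
      exact LeafRel.eventually_leaf_flowU_eq hφ hr
    | refl p =>
      intro v v' hv hv'
      exact Eventually.of_forall fun t => by rw [N.toF_flowU_eq hφ s (hv.trans hv'.symm)]
    | symm p q _ ih =>
      intro v v' hv hv'
      filter_upwards [ih v' v hv' hv] with t ht using ht.symm
    | trans p q r _ _ ih1 ih2 =>
      intro v v' hv hv'
      obtain ⟨u, hu⟩ := N.toF_surjective s q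
      filter_upwards [ih1 v u hv hu, ih2 u v' hu hv'] with t h1 h2 using h1.trans h2
  exact key _ _ (Quot.eqvGen_exact h) v v' rfl rfl

theorem toGlued_eq_of_glue {a : N.LeafSpace .plus} {b : N.LeafSpace .minus} (h : N.Glue a b) :
    N.toGlued .plus a = N.toGlued .minus b :=
  Quot.sound ⟨a, b, rfl, rfl, h⟩

section LeafFlow

variable [TopologicalSpace (N.LeafSpace s)] [ChartedSpace C2 (N.LeafSpace s)]
  [IsManifold 𝓘(ℂ, C2) ω (N.LeafSpace s)]

/-- If the leaf map is holomorphic, then so is the leaf of the image under the flow of a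
holomorphic family of vectors parametrized by the leaf space. -/
theorem contMDiffAt_leaf_flowU (hleaf : N.IsLeafManifold s) {t : ℂ} {a : N.LeafSpace s}
    {c : N.LeafSpace s → N.NonzeroU s}
    (hc : ContMDiffAt 𝓘(ℂ, C2) (𝓘(ℂ, C2).prod 𝓘(ℂ, C4)) ω (fun a => (c a).1) a)
    (hdom : (t, (c a).1.1) ∈ φ.domain) :
    ContMDiffAt (𝓘(ℂ, ℂ).prod 𝓘(ℂ, C2)) 𝓘(ℂ, C2) ω
      (fun q : ℂ × N.LeafSpace s => N.leaf s (N.toF s (N.flowU hφ s q.1 (c q.2)))) (t, a) := by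
  -- `IsLeafManifold.holomorphic` concerns families parametrized by a vector space, so the leaf
  -- space is replaced by its chart and the family lives on `ℂ × C2`.
  let χ := extChartAt 𝓘(ℂ, C2) a
  have hχ : χ.symm (χ a) = a := extChartAt_to_inv a
  have hsymm₀ : ContMDiffAt 𝓘(ℂ, C2) 𝓘(ℂ, C2) ω χ.symm (χ a) :=
    (contMDiffOn_extChartAt_symm a).contMDiffAt (extChartAt_target_mem_nhds a)
  have hsymm : ContMDiffAt 𝓘(ℂ, ℂ × C2) 𝓘(ℂ, C2) ω (fun q : ℂ × C2 => χ.symm q.2) (t, χ a) :=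
    ContMDiffAt.comp (t, χ a) (g := χ.symm) (f := fun q : ℂ × C2 => q.2)
      hsymm₀ (contDiff_snd.contMDiff _)
  have hcχ : ContMDiffAt 𝓘(ℂ, ℂ × C2) (𝓘(ℂ, C2).prod 𝓘(ℂ, C4)) ω
      (fun q : ℂ × C2 => (c (χ.symm q.2)).1) (t, χ a) :=
    ContMDiffAt.comp (t, χ a) (g := fun a => (c a).1) (f := fun q : ℂ × C2 => χ.symm q.2)
      (by simpa only [hχ] using hc) hsymm
  have hfst : ContMDiffAt 𝓘(ℂ, ℂ × C2) 𝓘(ℂ, ℂ) ω (fun q : ℂ × C2 => q.1) (t, χ a) :=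
    contDiff_fst.contMDiff _
  have hpush : ContMDiffAt 𝓘(ℂ, ℂ × C2) (𝓘(ℂ, C2).prod 𝓘(ℂ, C4)) ω
      (fun q : ℂ × C2 => pushTot φ q.1 (c (χ.symm q.2)).1) (t, χ a) :=
    ContMDiffAt.comp (t, χ a) (g := fun q : ℂ × TotV S ρ => pushTot φ q.1 q.2)
      (f := fun q : ℂ × C2 => (q.1, (c (χ.symm q.2)).1))
      (hφ.contMDiffAt_pushTot (by simpa only [hχ] using hdom)) (hfst.prodMk hcχ)
  have hev : ∀ᶠ q : ℂ × C2 in 𝓝 (t, χ a), (q.1, (c (χ.symm q.2)).1.1) ∈ φ.domain := by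
    have hcont : ContinuousAt (fun q : ℂ × C2 => (q.1, (c (χ.symm q.2)).1.1)) (t, χ a) :=
      continuousAt_fst.prodMk
        (ContinuousAt.comp continuous_totV_proj.continuousAt hcχ.continuousAt)
    exact hcont.eventually (φ.isOpen_domain.mem_nhds (by simpa only [hχ] using hdom))
  have hflow := hleaf.holomorphic (ℂ × C2) (fun q => N.flowU hφ s q.1 (c (χ.symm q.2))) (t, χ a)
    (hpush.congr_of_eventuallyEq (hev.mono fun q hq => N.flowU_val hφ s hq))
  have hchart : ContMDiffAt (𝓘(ℂ, ℂ).prod 𝓘(ℂ, C2)) 𝓘(ℂ, ℂ × C2) ω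
      (fun q : ℂ × N.LeafSpace s => (q.1, χ q.2)) (t, a) :=
    contMDiffAt_fst.prodMk_space (ContMDiffAt.comp (t, a) (g := χ)
      (f := fun q : ℂ × N.LeafSpace s => q.2) contMDiffAt_extChartAt contMDiffAt_snd)
  have hcomp := ContMDiffAt.comp (t, a) (f := fun q : ℂ × N.LeafSpace s => (q.1, χ q.2))
    hflow hchart
  refine hcomp.congr_of_eventuallyEq ?_
  filter_upwards [continuousAt_snd.eventually (extChartAt_source_mem_nhds (I := 𝓘(ℂ, C2)) a)]
    with q hq
  have : χ.symm (χ q.2) = q.2 := χ.left_inv hq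
  simp only [Function.comp_apply, this]

/-- The flow on the nonzero vectors of `U^±` descends to the leaf space. -/
noncomputable def leafFlow (hleaf : N.IsLeafManifold s) :
    DescendingFlow (fun v : N.NonzeroU s => N.leaf s (N.toF s v)) where
  dom := {q | (q.1, q.2.1.1) ∈ φ.domain}
  flow := N.flowU hφ s
  surj a := by
    obtain ⟨p, rfl⟩ := Quot.exists_rep a
    obtain ⟨v, rfl⟩ := N.toF_surjective s p
    exact ⟨v, rfl⟩
  zero_mem v := φ.zero_mem _
  star_mem t v h r h0 h1 := φ.star_mem t _ h r h0 h1
  map_zero v := by rw [flowU_zero]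
  germ v v' h := eventually_leaf_flowU_eq hφ h
  section_exists t v h := by
    obtain ⟨c, hc, hcv, hca⟩ := hleaf.submersion v
    have hdom : (t, (c (N.leaf s (N.toF s v))).1.1) ∈ φ.domain := by rw [hcv]; exact h
    have hcont : ContinuousAt (fun q : ℂ × N.LeafSpace s => (q.1, (c q.2).1.1))
        (t, N.leaf s (N.toF s v)) :=
      continuousAt_fst.prodMk (ContinuousAt.comp continuous_totV_proj.continuousAt
        (ContinuousAt.comp (g := fun a => (c a).1) (f := fun q : ℂ × N.LeafSpace s => q.2)
          hc.continuousAt continuousAt_snd))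
    refine ⟨c, hcv, hca, hcont.eventually (φ.isOpen_domain.mem_nhds hdom),
      contMDiffAt_leaf_flowU hφ hleaf hc hdom, ?_⟩
    have hcont2 : ContinuousAt
        (fun q : ℂ × (ℂ × N.LeafSpace s) => (q.1, (q.2.1, (c q.2.2).1)))
        ((0 : ℂ), (t, N.leaf s (N.toF s v))) :=
      continuousAt_fst.prodMk ((continuousAt_fst.comp continuousAt_snd).prodMk
        (ContinuousAt.comp (g := fun a => (c a).1)
          (f := fun q : ℂ × (ℂ × N.LeafSpace s) => q.2.2)
          hc.continuousAt (continuousAt_snd.comp continuousAt_snd)))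
    have hcont3 : ContinuousAt
        (fun q : ℂ × (ℂ × N.LeafSpace s) => (q.2.1 + q.1, (c q.2.2).1.1))
        ((0 : ℂ), (t, N.leaf s (N.toF s v))) := by
      refine ContinuousAt.prodMk (by fun_prop) ?_
      exact ContinuousAt.comp continuous_totV_proj.continuousAt
        (ContinuousAt.comp (g := fun a => (c a).1)
          (f := fun q : ℂ × (ℂ × N.LeafSpace s) => q.2.2)
          hc.continuousAt (continuousAt_snd.comp continuousAt_snd))
    filter_upwards [hcont2.eventually (hφ.eventually_pushTot_add hdom),
      hcont3.eventually (φ.isOpen_domain.mem_nhds (by simpa using hdom))] with q hq1 hq2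
    obtain ⟨h1, h2, h3⟩ := hq1
    have hval := N.flowU_val hφ s (v := c q.2.2) h1
    have hmem : (q.1, (N.flowU hφ s q.2.1 (c q.2.2)).1.1) ∈ φ.domain := by
      rw [hval]
      exact h2
    refine ⟨hmem, ?_⟩
    have : N.flowU hφ s (q.2.1 + q.1) (c q.2.2) =
        N.flowU hφ s q.1 (N.flowU hφ s q.2.1 (c q.2.2)) := by
      refine Subtype.ext ?_
      rw [N.flowU_val hφ s hq2, N.flowU_val hφ s hmem, hval]
      exact h3.symm
    exact congrArg (fun v => N.leaf s (N.toF s v)) this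

variable [T2Space (N.LeafSpace s)]

theorem leafFlow_localFlow_toFun (hleaf : N.IsLeafManifold s) {t : ℂ} {v : N.NonzeroU s}
    (h : (t, v.1.1) ∈ φ.domain) :
    (leafFlow hφ hleaf).localFlow.toFun t (N.leaf s (N.toF s v)) =
      N.leaf s (N.toF s ⟨pushTot φ t v.1, N.pushTot_mem hφ s h v.2⟩) := by
  rw [← N.flowU_eq hφ s h]
  exact (leafFlow hφ hleaf).baseFlow_apply h

theorem linePoint_eq {x : S} {l : V ρ x} (hl : l ∈ C.L x) (hl0 : l ≠ 0) :
    linePoint C x = ⟨x, Projectivization.mk ℂ l hl0⟩ := by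
  refine congrArg (Sigma.mk x) (Projectivization.submodule_injective ?_)
  rw [Projectivization.submodule_mk'', Projectivization.submodule_mk]
  have : FiniteDimensional ℂ (V ρ x) := inferInstanceAs (FiniteDimensional ℂ C4)
  symm
  refine Submodule.eq_of_le_of_finrank_eq ((Submodule.span_singleton_le_iff_mem _ _).2 hl) ?_
  rw [finrank_span_singleton hl0, C.finrank_L]

/-- A nonzero vector of `Λ_x` lies in `U^±` and represents this point; its image lies in `Λ` again.
-/
theorem linePoint_mem_leafSet (hleaf : N.IsLeafManifold s) {t : ℂ} {x : S}
    (h : (t, x) ∈ φ.domain) {a : N.LeafSpace s} (ha : linePoint C x ∈ N.leafSet s a) :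
    linePoint C (φ.toFun t x) ∈ N.leafSet s ((leafFlow hφ hleaf).localFlow.toFun t a) := by
  obtain ⟨p, rfl, hp⟩ := ha
  obtain ⟨l, hl, hl0⟩ : ∃ l ∈ C.L x, l ≠ 0 := by
    refine Submodule.exists_mem_ne_zero_of_ne_bot fun h0 => ?_
    have := C.finrank_L x
    rw [h0, finrank_bot] at this
    exact zero_ne_one this
  let v : N.NonzeroU s := ⟨⟨x, l⟩, N.L_le s x hl, hl0⟩
  have hv : N.toF s v = p := Subtype.ext ((linePoint_eq hl hl0).symm.trans hp.symm)
  refine ⟨N.toF s ⟨pushTot φ t v.1, N.pushTot_mem hφ s h v.2⟩, ?_, ?_⟩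
  · rw [← hv, leafFlow_localFlow_toFun hφ hleaf (v := v) h]
  · exact (linePoint_eq (hφ.line t x h l hl) (hφ.push_ne_zero h hl0)).symm

end LeafFlow

/-! ### Compatibility with the gluing and the flow on `T`. -/

variable [∀ s, TopologicalSpace (N.LeafSpace s)] [∀ s, T2Space (N.LeafSpace s)]
  [∀ s, ChartedSpace C2 (N.LeafSpace s)] [∀ s, IsManifold 𝓘(ℂ, C2) ω (N.LeafSpace s)]
  (hleaf : ∀ s, N.IsLeafManifold s)
  (hmeet : ∀ (a : N.LeafSpace .plus) (b : N.LeafSpace .minus),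
    (N.leafSet .plus a ∩ N.leafSet .minus b).Subsingleton)

include hmeet in
/-- Leaves that meet in `ℙ(Λ)_x` are sent to leaves that meet in `ℙ(Λ)_{φ_t x}`. -/
theorem leafSet_inter_flow {t : ℂ} {x : S} (h : (t, x) ∈ φ.domain) {a : N.LeafSpace .plus}
    {b : N.LeafSpace .minus} (hab : N.leafSet .plus a ∩ N.leafSet .minus b = {linePoint C x}) :
    N.leafSet .plus ((leafFlow hφ (hleaf .plus)).localFlow.toFun t a) ∩
      N.leafSet .minus ((leafFlow hφ (hleaf .minus)).localFlow.toFun t b) =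
        {linePoint C (φ.toFun t x)} := by
  have hmem : linePoint C x ∈ N.leafSet .plus a ∩ N.leafSet .minus b := by
    rw [hab]
    rfl
  exact (hmeet _ _).eq_singleton_of_mem
    ⟨linePoint_mem_leafSet hφ (hleaf _) h hmem.1, linePoint_mem_leafSet hφ (hleaf _) h hmem.2⟩

-- The meeting point of two glued leaves stays in the open domain of the flow for small times, so
-- their images are glued too; the generated equivalence needs only finitely many such steps.
include hmeet in
theorem eventually_toGlued_eq {s s' : Side} {a : N.LeafSpace s} {a' : N.LeafSpace s'}
    (h : N.toGlued s a = N.toGlued s' a') :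
    ∀ᶠ t in 𝓝 (0 : ℂ), N.toGlued s ((leafFlow hφ (hleaf s)).localFlow.toFun t a) =
      N.toGlued s' ((leafFlow hφ (hleaf s')).localFlow.toFun t a') := by
  let val : ℂ → N.LeafSpace .plus ⊕ N.LeafSpace .minus → N.Glued := fun t =>
    Sum.elim (fun a => N.toGlued .plus ((leafFlow hφ (hleaf .plus)).localFlow.toFun t a))
      (fun b => N.toGlued .minus ((leafFlow hφ (hleaf .minus)).localFlow.toFun t b))
  have key : ∀ u v, Relation.EqvGen (fun u v : N.LeafSpace .plus ⊕ N.LeafSpace .minus =>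
      ∃ a b, u = Sum.inl a ∧ v = Sum.inr b ∧ N.Glue a b) u v →
      ∀ᶠ t in 𝓝 (0 : ℂ), val t u = val t v := by
    intro u v huv
    induction huv with
    | rel u v hr =>
      obtain ⟨a, b, rfl, rfl, x, hx⟩ := hr
      have hdom : ∀ᶠ t in 𝓝 (0 : ℂ), (t, x) ∈ φ.domain :=
        (Continuous.prodMk_left x).continuousAt.eventually
          (φ.isOpen_domain.mem_nhds (φ.zero_mem x))
      filter_upwards [hdom] with t ht
      exact toGlued_eq_of_glue ⟨_, leafSet_inter_flow hφ hleaf hmeet ht hx⟩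
    | refl u => exact Eventually.of_forall fun t => rfl
    | symm u v _ ih => filter_upwards [ih] with t ht using ht.symm
    | trans u v w _ _ ih1 ih2 => filter_upwards [ih1, ih2] with t h1 h2 using h1.trans h2
  cases s <;> cases s' <;> exact key _ _ (Quot.eqvGen_exact h)

variable [TopologicalSpace N.Glued] [ChartedSpace C2 N.Glued]

/-- The flows on the two leaf spaces descend to the glued space. -/
noncomputable def gluedFlow
    (hglued : ∀ s, IsLocalDiffeomorph 𝓘(ℂ, C2) 𝓘(ℂ, C2) ω (N.toGlued s)) :
    DescendingFlow (fun e : Σ s, N.LeafSpace s => N.toGlued e.1 e.2) where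
  dom := {q | (q.1, q.2.2) ∈ (leafFlow hφ (hleaf q.2.1)).localFlow.domain}
  flow t e := ⟨e.1, (leafFlow hφ (hleaf e.1)).localFlow.toFun t e.2⟩
  surj c := by
    obtain ⟨a | b, rfl⟩ := Quot.exists_rep c
    · exact ⟨⟨.plus, a⟩, rfl⟩
    · exact ⟨⟨.minus, b⟩, rfl⟩
  zero_mem e := LocalFlow.zero_mem (leafFlow hφ (hleaf e.1)).localFlow e.2
  star_mem t e h := LocalFlow.star_mem (leafFlow hφ (hleaf e.1)).localFlow t e.2 h
  map_zero e := congrArg (N.toGlued e.1) (LocalFlow.map_zero (leafFlow hφ (hleaf e.1)).localFlow e.2)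
  germ e e' h := eventually_toGlued_eq hφ hleaf hmeet h
  section_exists := by
    rintro t ⟨s, a⟩ h
    -- A local inverse of `T^± → T` is the required local section; it keeps the label `s` fixed.
    obtain ⟨Φ, ha, hΦ⟩ := hglued s a
    let ψ := (leafFlow hφ (hleaf s)).localFlow
    have hb : N.toGlued s a ∈ Φ.target := by
      rw [hΦ ha]
      exact Φ.map_source' ha
    have hinv : Φ.symm (N.toGlued s a) = a := by
      rw [hΦ ha]
      exact Φ.left_inv' ha
    have htar : Φ.target ∈ 𝓝 (N.toGlued s a) := Φ.open_target.mem_nhds hb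
    have hsm : ContMDiffAt 𝓘(ℂ, C2) 𝓘(ℂ, C2) ω Φ.symm (N.toGlued s a) :=
      Φ.contMDiffOn_invFun.contMDiffAt htar
    have hdom : (t, Φ.symm (N.toGlued s a)) ∈ ψ.domain := by rwa [hinv]
    have hsm2 : ContMDiffAt (𝓘(ℂ, ℂ).prod 𝓘(ℂ, C2)) (𝓘(ℂ, ℂ).prod 𝓘(ℂ, C2)) ω
        (fun q : ℂ × N.Glued => (q.1, Φ.symm q.2)) (t, N.toGlued s a) :=
      contMDiffAt_fst.prodMk (ContMDiffAt.comp (t, N.toGlued s a) (g := Φ.symm)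
        (f := fun q : ℂ × N.Glued => q.2) hsm contMDiffAt_snd)
    refine ⟨fun b => ⟨s, Φ.symm b⟩, congrArg (Sigma.mk s) hinv, ?_,
      hsm2.continuousAt.eventually (ψ.isOpen_domain.mem_nhds hdom), ?_, ?_⟩
    · filter_upwards [htar] with b hb
      exact (hΦ (Φ.map_target' hb)).trans (Φ.right_inv' hb)
    · exact ContMDiffAt.comp (t, N.toGlued s a) (g := N.toGlued s)
        ((hglued s).contMDiff _) (ContMDiffAt.comp (t, N.toGlued s a)
          (g := fun p : ℂ × N.LeafSpace s => ψ.toFun p.1 p.2) (ψ.contMDiffAt hdom) hsm2)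
    · have hcont : ContinuousAt (fun q : ℂ × (ℂ × N.Glued) => (q.1, (q.2.1, Φ.symm q.2.2)))
          ((0 : ℂ), (t, N.toGlued s a)) :=
        continuousAt_fst.prodMk (ContinuousAt.comp
          (g := fun q : ℂ × N.Glued => (q.1, Φ.symm q.2)) hsm2.continuousAt continuousAt_snd)
      filter_upwards [hcont.eventually (ψ.eventually_add hdom)] with q hq
      exact ⟨hq.2.1, congrArg (N.toGlued s) hq.2.2.self_of_nhds⟩

end NullSubbundles

end CartanGluing

/-! ### The main theorem. -/

open CartanGluing CartanGluing.NullSubbundles in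
theorem mainTheorem4
    {S : Type*} [TopologicalSpace S] [T2Space S] [ChartedSpace C2 S] [IsManifold 𝓘(ℂ, C2) ω S]
    -- the conformal Cartan connection on the complex surface `S`, with its null subbundles
    (ρ : HolRep) (C : ConformalCartan S ρ) (N : NullSubbundles C)
    -- a holomorphic vector field `X` whose local flow preserves the Cartan connection
    (X : Π x : S, TangentSpace 𝓘(ℂ, C2) x) (hX : IsHolomorphicVectorField X)
    (φ : LocalFlow X) (hφ : C.IsPreservedBy φ)
    -- the restrictions on `S`: the leaf spaces are (Hausdorff) complex surfaces, and a lifted curve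
    -- of one family meets a lifted curve of the other family at most once
    [∀ s, TopologicalSpace (N.LeafSpace s)] [∀ s, T2Space (N.LeafSpace s)]
    [∀ s, ChartedSpace C2 (N.LeafSpace s)] [∀ s, IsManifold 𝓘(ℂ, C2) ω (N.LeafSpace s)]
    (hleaf : ∀ s, N.IsLeafManifold s)
    (hmeet : ∀ (a : N.LeafSpace .plus) (b : N.LeafSpace .minus),
      (N.leafSet .plus a ∩ N.leafSet .minus b).Subsingleton)
    -- the glued space `T` is a complex surface whose structure is glued from those of `T⁺`, `T⁻`
    [TopologicalSpace N.Glued] [T2Space N.Glued] [ChartedSpace C2 N.Glued]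
    [IsManifold 𝓘(ℂ, C2) ω N.Glued]
    (hglued : ∀ s, IsLocalDiffeomorph 𝓘(ℂ, C2) 𝓘(ℂ, C2) ω (N.toGlued s)) :
    ∃ (X' : ∀ s, Π a : N.LeafSpace s, TangentSpace 𝓘(ℂ, C2) a) (ψ : ∀ s, LocalFlow (X' s))
      (Y : Π a : N.Glued, TangentSpace 𝓘(ℂ, C2) a) (Ψ : LocalFlow Y),
      -- `ψ s` is the flow induced on the leaf space: the leaf through `v` goes to the leaf through
      -- the image `(φ_t x, (φ_t)_* v)` of `v`
      (∀ s t a, (t, a) ∈ (ψ s).domain ↔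
        ∃ v : N.NonzeroU s, N.leaf s (N.toF s v) = a ∧ (t, v.1.1) ∈ φ.domain) ∧
      (∀ s t (v : N.NonzeroU s), (t, v.1.1) ∈ φ.domain →
        ∃ h, (ψ s).toFun t (N.leaf s (N.toF s v)) =
          N.leaf s (N.toF s ⟨⟨φ.toFun t v.1.1, push ρ φ t v.1.1 v.1.2⟩, h⟩)) ∧
      -- compatibility with the gluing: leaves that meet in `ℙ(Λ)_x` go to leaves that meet in
      -- `ℙ(Λ)_{φ_t x}`, and points that are glued are sent to points with the same image in `T`
      (∀ t x a b, (t, x) ∈ φ.domain →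
        N.leafSet .plus a ∩ N.leafSet .minus b = {linePoint C x} →
        N.leafSet .plus ((ψ .plus).toFun t a) ∩ N.leafSet .minus ((ψ .minus).toFun t b) =
          {linePoint C (φ.toFun t x)}) ∧
      (∀ t a b, N.Glue a b → (t, a) ∈ (ψ .plus).domain → (t, b) ∈ (ψ .minus).domain →
        N.toGlued .plus ((ψ .plus).toFun t a) = N.toGlued .minus ((ψ .minus).toFun t b)) ∧
      -- the induced flow `Ψ` on `T`, with its holomorphic generator `Y`
      (∀ t c, (t, c) ∈ Ψ.domain ↔
        ∃ s, ∃ a : N.LeafSpace s, N.toGlued s a = c ∧ (t, a) ∈ (ψ s).domain) ∧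
      (∀ s t a, (t, a) ∈ (ψ s).domain →
        Ψ.toFun t (N.toGlued s a) = N.toGlued s ((ψ s).toFun t a)) ∧
      (∀ s, IsHolomorphicVectorField (X' s)) ∧
      IsHolomorphicVectorField Y
 := by
  refine ⟨fun s => (leafFlow hφ (hleaf s)).generator, fun s => (leafFlow hφ (hleaf s)).localFlow,
    (gluedFlow hφ hleaf hmeet hglued).generator, (gluedFlow hφ hleaf hmeet hglued).localFlow,
    fun s t a => Iff.rfl,
    fun s t v h => ⟨N.pushTot_mem hφ s h v.2, leafFlow_localFlow_toFun hφ (hleaf s) h⟩,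
    fun t x a b h hab => leafSet_inter_flow hφ hleaf hmeet h hab,
    fun t a b hab ha hb => ?_, fun t c => ?_, fun s t a h => ?_,
    fun s => LocalFlow.isHolomorphicVectorField (leafFlow hφ (hleaf s)).localFlow,
    LocalFlow.isHolomorphicVectorField (gluedFlow hφ hleaf hmeet hglued).localFlow⟩
  -- At time `t` the flow need not be defined at the meeting point of the leaves, so
  -- `leafSet_inter_flow` does not suffice; continuation along the segment from `0` to `t` gives
  -- equality in `T`.
  · exact (gluedFlow hφ hleaf hmeet hglued).flow_eq (e := ⟨.plus, a⟩) (e' := ⟨.minus, b⟩) ha hb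
      (toGlued_eq_of_glue hab)
  · exact ⟨fun ⟨e, he, hm⟩ => ⟨e.1, e.2, he, hm⟩, fun ⟨s, a, ha, hm⟩ => ⟨⟨s, a⟩, ha, hm⟩⟩
  · exact (gluedFlow hφ hleaf hmeet hglued).baseFlow_apply (e := ⟨s, a⟩) h
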